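/- Let $E=(E^0,E^1,s,r)$ be a finite directed graph (loops and multiple edges allowed) with at least one vertex, where $s(e)$ and $r(e)$ are the source and the range of the edge $e$, and let $K$ be any field. Let $L_K(E)$ be the Leavitt path algebra of $E$ over $K$, that is, the unital $K$-algebra generated by $\{v,e,e^* : v\in E^0,\ e\in E^1\}$ subject to the relations, for all $v,w\in E^0$ and $e,f\in E^1$: $vw=\delta_{v,w}w$; $s(e)e=e=e\,r(e)$ and $r(e)e^*=e^*=e^*s(e)$; $e^*f=\delta_{e,f}r(e)$; $v=\sum_{s(e)=v}ee^*$ whenever $v$ is the source of at least one edge; and $1=\sum_{v\in E^0}v$. Write $R=L_K(E)$; all modules are right $R$-modules. Then the following are equivalent: 1. $R$ has cancellation of projectives: for all finitely generated projective $P,P'$, if $P\oplus R\cong P'\oplus R$ then $P\cong P'$; 2. $R$ is Hermite: for all integers $m,n\ge 1$ and every module $M$, if $R^n\cong R^m\oplus M$ then $n\ge m$ and $M\cong R^{n-m}$; 3. $R$ is stably finite: for every integer $n\ge 1$ and every module $M$, if $R^n\cong R^n\oplus M$ then $M=0$; 4. $R$ is directly finite: for all $a,b\in R$, if $ab=1$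 then $ba=1$; 5. no cycle of $E$ has an exit, where a cycle is a sequence of edges $e_1\cdots e_n$ ($n\ge 1$) with $r(e_i)=s(e_{i+1})$ for $1\le i<n$, $r(e_n)=s(e_1)$ and $s(e_1),\dots,s(e_n)$ distinct, and an exit for it is an edge $f$ such that $s(f)=s(e_i)$ and $f\ne e_i$ for some $i$. -/

import Mathlib

/-! ### Directed graphs, paths, cycles, exits -/

/-- A directed graph with vertex set `V` and edge set `E` (loops and parallel edges allowed):
every edge `e` has a source `s e` and a range `r e`. -/
structure DirectedGraph (V : Type*) (E : Type*) where
  /-- the source of an edge -/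
  s : E → V
  /-- the range of an edge -/
  r : E → V

namespace DirectedGraph

variable {V E : Type*} (G : DirectedGraph V E)

/-- A path of positive length: a nonempty sequence `e₁ ⋯ eₙ` of edges with
`r eᵢ = s eᵢ₊₁` for `1 ≤ i < n`. -/
def IsPath (p : List E) : Prop :=
  p ≠ [] ∧ p.IsChain (fun e f => G.r e = G.s f)

/-- A cycle: a closed path `e₁ ⋯ eₙ` (`n ≥ 1`, `r eₙ = s e₁`) whose vertices `s e₁, …, s eₙ`
are distinct. -/
def IsCycle (p : List E) : Prop :=
  G.IsPath p ∧ (∀ h : p ≠ [], G.r (p.getLast h) = G.s (p.head h)) ∧ (p.map G.s).Nodup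

/-- The edge `f` is an exit for `p = e₁ ⋯ eₙ`: for some `i`, `s f = s eᵢ` but `f ≠ eᵢ`. -/
def IsExit (f : E) (p : List E) : Prop :=
  ∃ e ∈ p, G.s f = G.s e ∧ f ≠ e

/-- A no-exit graph: no cycle has an exit. -/
def NoExit : Prop :=
  ∀ p : List E, G.IsCycle p → ∀ f : E, ¬ G.IsExit f p

end DirectedGraph

/-! ### The Leavitt path algebra of a finite graph -/

/-- The generators `v`, `e`, `e*` (for vertices `v` and edges `e`). -/
inductive LeavittGen (V : Type*) (E : Type*) where
  | vertex (v : V) : LeavittGen V E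
  | edge (e : E) : LeavittGen V E
  | ghost (e : E) : LeavittGen V E

section Leavitt

variable (K : Type*) [Field K] {V E : Type*}

/-- The vertex `v` as an element of the free unital `K`-algebra on the generators. -/
def LeavittGen.vert (E : Type*) (v : V) : FreeAlgebra K (LeavittGen V E) :=
  FreeAlgebra.ι K (LeavittGen.vertex v)

/-- The edge `e` as an element of the free unital `K`-algebra on the generators. -/
def LeavittGen.edg (V : Type*) (e : E) : FreeAlgebra K (LeavittGen V E) :=
  FreeAlgebra.ι K (LeavittGen.edge e)

/-- The ghost edge `e*` as an element of the free unital `K`-algebra on the generators. -/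
def LeavittGen.gho (V : Type*) (e : E) : FreeAlgebra K (LeavittGen V E) :=
  FreeAlgebra.ι K (LeavittGen.ghost e)

variable [Fintype V] [Fintype E] [DecidableEq V] (G : DirectedGraph V E)

open LeavittGen in
/-- The defining relations of the Leavitt path algebra of a finite graph. The last relation,
`1 = ∑ v`, is there because the presentation is formed among *unital* algebras: for a finite graph
`∑ v` is an identity element of the (not a priori unital) algebra presented by the other
relations, and the identity of the Leavitt path algebra is this element. -/
inductive LeavittRel :
    FreeAlgebra K (LeavittGen V E) → FreeAlgebra K (LeavittGen V E) → Prop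
  /-- `v v = v` -/
  | vertex_mul_self (v : V) : LeavittRel (vert K E v * vert K E v) (vert K E v)
  /-- `v w = 0` for `v ≠ w` -/
  | vertex_mul_of_ne (v w : V) (h : v ≠ w) : LeavittRel (vert K E v * vert K E w) 0
  /-- `s(e) e = e` -/
  | source_mul_edge (e : E) : LeavittRel (vert K E (G.s e) * edg K V e) (edg K V e)
  /-- `e r(e) = e` -/
  | edge_mul_range (e : E) : LeavittRel (edg K V e * vert K E (G.r e)) (edg K V e)
  /-- `r(e) e* = e*` -/
  | range_mul_ghost (e : E) : LeavittRel (vert K E (G.r e) * gho K V e) (gho K V e)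
  /-- `e* s(e) = e*` -/
  | ghost_mul_source (e : E) : LeavittRel (gho K V e * vert K E (G.s e)) (gho K V e)
  /-- `e* e = r(e)` -/
  | ghost_mul_edge_self (e : E) : LeavittRel (gho K V e * edg K V e) (vert K E (G.r e))
  /-- `e* f = 0` for `e ≠ f` -/
  | ghost_mul_edge_of_ne (e f : E) (h : e ≠ f) : LeavittRel (gho K V e * edg K V f) 0
  /-- `v = ∑_{s(e) = v} e e*` for every regular vertex `v`, that is, every `v` emitting an edge -/
  | vertex_eq_sum (v : V) (h : ∃ e : E, G.s e = v) :
      LeavittRel (vert K E v) (∑ e : E with G.s e = v, edg K V e * gho K V e)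
  /-- the identity is the sum of the vertices -/
  | one_eq_sum : LeavittRel 1 (∑ v : V, vert K E v)

/-- The Leavitt path algebra `L_K(E)` of a finite directed graph with coefficients in `K`. -/
def LeavittPathAlgebra : Type _ :=
  RingQuot (LeavittRel K G)

noncomputable instance : Ring (LeavittPathAlgebra K G) :=
  inferInstanceAs (Ring (RingQuot (LeavittRel K G)))

noncomputable instance : Algebra K (LeavittPathAlgebra K G) :=
  inferInstanceAs (Algebra K (RingQuot (LeavittRel K G)))

end Leavitt

/-! ### Cancellation properties of a ring

Right `R`-modules are `Rᵐᵒᵖ`-modules; `R` itself and `Fin n → R` (that is, `Rⁿ`) carry their usual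
right `R`-module structure. All modules that matter are finitely generated (a direct summand of
`Rⁿ` is), so every isomorphism class has a representative in the universe of `R`. -/

section Cancellation

universe u

variable (R : Type u) [Ring R]

/-- `R` is directly finite: `a b = 1` implies `b a = 1`. -/
def IsDirectlyFinite : Prop :=
  ∀ a b : R, a * b = 1 → b * a = 1

/-- `R` is stably finite: for every `n ≥ 1` and every right module `M`,
`Rⁿ ≅ Rⁿ ⊕ M` implies `M = 0`. -/
def IsStablyFinite : Prop :=
  ∀ n : ℕ, 0 < n → ∀ (M : Type u) [AddCommGroup M] [Module Rᵐᵒᵖ M],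
    Nonempty ((Fin n → R) ≃ₗ[Rᵐᵒᵖ] (Fin n → R) × M) → Subsingleton M

/-- `R` is Hermite (in the sense of P. M. Cohn): for all `m, n ≥ 1` and every right module `M`,
`Rⁿ ≅ Rᵐ ⊕ M` implies `n ≥ m` and `M ≅ Rⁿ⁻ᵐ`. -/
def IsHermiteRing : Prop :=
  ∀ m n : ℕ, 0 < m → 0 < n → ∀ (M : Type u) [AddCommGroup M] [Module Rᵐᵒᵖ M],
    Nonempty ((Fin n → R) ≃ₗ[Rᵐᵒᵖ] (Fin m → R) × M) →
      m ≤ n ∧ Nonempty (M ≃ₗ[Rᵐᵒᵖ] (Fin (n - m) → R))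

/-- `R` has cancellation of projectives: for finitely generated projective right modules
`P` and `Q`, `P ⊕ R ≅ Q ⊕ R` implies `P ≅ Q`. -/
def HasCancellationOfProjectives : Prop :=
  ∀ (P Q : Type u) [AddCommGroup P] [Module Rᵐᵒᵖ P] [AddCommGroup Q] [Module Rᵐᵒᵖ Q],
    Module.Finite Rᵐᵒᵖ P → Module.Projective Rᵐᵒᵖ P →
    Module.Finite Rᵐᵒᵖ Q → Module.Projective Rᵐᵒᵖ Q →
      Nonempty ((P × R) ≃ₗ[Rᵐᵒᵖ] (Q × R)) → Nonempty (P ≃ₗ[Rᵐᵒᵖ] Q)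

end Cancellation

/-! The implications 1 → 2 → 3 → 4 are module theory; only the first needs the ring to be
nontrivial, and this holds because vertices are nonzero (`vertex_ne_zero`).

For 4 → 5, let `c` be a closed path at `v` that begins with the cycle edge `e`, and `d` its ghost.
Then `d c = v`, and direct finiteness forces `c d = v`. An exit `f ≠ e` at `v` then gives `r(f) = f*
v f = f* c d f = 0`, since `f* e = 0`; but vertices are nonzero.

For 5 → 1, in a finite graph without exits every path can be continued to a terminal vertex, either
a sink or a vertex of a cycle that cannot be left. Choose one vertex `t` in each terminal class. The
corners `t R t` are `K` at a sink and `K[T,T⁻¹]` at a cycle (`nonempty_cornerIso_sink`,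
`nonempty_cornerIso_cycle`), `s R t = 0` for different representatives (`corner_eq_zero`), and
together the representatives generate the unit ideal (`one_mem_closure`). Thus `R` behaves like a
finite product of principal ideal domains up to Morita equivalence: a finitely generated projective
`P` is recovered from the free modules `P t`, hence from their ranks, and ranks cancel
(`hasCancellationOfProjectives_of_corners`). -/

/-! ### General implications between cancellation properties -/

section CancellationGeneral

universe u

variable {R : Type u} [Ring R]

/-- A ring, as a right module over itself, is isomorphic to its opposite as a left module over
its opposite. -/
def opRegularEquiv (R : Type u) [Ring R] : Rᵐᵒᵖ ≃ₗ[Rᵐᵒᵖ] R where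
  toFun := MulOpposite.unop
  invFun := MulOpposite.op
  left_inv _ := rfl
  right_inv _ := rfl
  map_add' _ _ := rfl
  map_smul' _ _ := rfl

instance finite_right_regular : Module.Finite Rᵐᵒᵖ R :=
  Module.Finite.equiv (opRegularEquiv R)

instance free_right_regular : Module.Free Rᵐᵒᵖ R :=
  Module.Free.of_equiv (opRegularEquiv R)

theorem HasCancellationOfProjectives.cancel_pow (h : HasCancellationOfProjectives R) (k : ℕ)
    (P Q : Type u) [AddCommGroup P] [Module Rᵐᵒᵖ P] [AddCommGroup Q] [Module Rᵐᵒᵖ Q]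
    [Module.Finite Rᵐᵒᵖ P] [Module.Projective Rᵐᵒᵖ P]
    [Module.Finite Rᵐᵒᵖ Q] [Module.Projective Rᵐᵒᵖ Q]
    (φ : (P × (Fin k → R)) ≃ₗ[Rᵐᵒᵖ] (Q × (Fin k → R))) : Nonempty (P ≃ₗ[Rᵐᵒᵖ] Q) := by
  induction k with
  | zero =>
    exact ⟨(LinearEquiv.prodUnique (R := Rᵐᵒᵖ)).symm.trans
      (φ.trans (LinearEquiv.prodUnique (R := Rᵐᵒᵖ)))⟩
  | succ k ih =>
    have split : ∀ (N : Type u) [AddCommGroup N] [Module Rᵐᵒᵖ N],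
        Nonempty ((N × (Fin (k + 1) → R)) ≃ₗ[Rᵐᵒᵖ] ((N × (Fin k → R)) × R)) := fun N _ _ =>
      ⟨((LinearEquiv.refl Rᵐᵒᵖ N).prodCongr
        ((Fin.consLinearEquiv Rᵐᵒᵖ (fun _ : Fin (k + 1) => R)).symm.trans
          (LinearEquiv.prodComm Rᵐᵒᵖ R (Fin k → R)))).trans
        (LinearEquiv.prodAssoc Rᵐᵒᵖ N (Fin k → R) R).symm⟩
    obtain ⟨a⟩ := split P
    obtain ⟨b⟩ := split Q
    obtain ⟨ψ⟩ := h (P × (Fin k → R)) (Q × (Fin k → R)) inferInstance inferInstance inferInstance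
      inferInstance ⟨a.symm.trans (φ.trans b)⟩
    exact ih ψ

/-- If `m ≤ n`, cancel `Rᵐ`. If `m > n`, cancelling `Rⁿ` would leave `M ⊕ Rᵐ⁻ⁿ ≅ 0`, which
nontriviality excludes. -/
theorem HasCancellationOfProjectives.isHermiteRing [Nontrivial R]
    (h : HasCancellationOfProjectives R) : IsHermiteRing R := by
  intro m n _ hn M _ _ ⟨φ⟩
  have split : ∀ a b : ℕ,
      Nonempty ((Fin (a + b) → R) ≃ₗ[Rᵐᵒᵖ] ((Fin a → R) × (Fin b → R))) := fun a b =>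
    ⟨(LinearEquiv.funCongrLeft Rᵐᵒᵖ R finSumFinEquiv).trans
      (LinearEquiv.sumArrowLequivProdArrow (Fin a) (Fin b) Rᵐᵒᵖ R)⟩
  have hfin : Module.Finite Rᵐᵒᵖ M :=
    Module.Finite.of_surjective (LinearMap.snd Rᵐᵒᵖ (Fin m → R) M ∘ₗ φ.toLinearMap)
      (Prod.snd_surjective.comp φ.surjective)
  have hproj : Module.Projective Rᵐᵒᵖ M :=
    Module.Projective.of_split (M := Fin n → R) (φ.symm.toLinearMap ∘ₗ LinearMap.inr Rᵐᵒᵖ (Fin m → R) M)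
      (LinearMap.snd Rᵐᵒᵖ (Fin m → R) M ∘ₗ φ.toLinearMap) (by ext; simp)
  rcases le_or_gt m n with hmn | hmn
  · refine ⟨hmn, ?_⟩
    obtain ⟨k, rfl⟩ := Nat.exists_eq_add_of_le hmn
    rw [Nat.add_sub_cancel_left]
    rw [add_comm] at φ
    obtain ⟨σ⟩ := split k m
    exact h.cancel_pow m _ _ ((LinearEquiv.prodComm Rᵐᵒᵖ M (Fin m → R)).trans
      (φ.symm.trans σ))
  · exfalso
    obtain ⟨k, rfl⟩ := Nat.exists_eq_add_of_lt hmn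
    rw [show n + k + 1 = (k + 1) + n by ring] at φ
    obtain ⟨σ⟩ := split (k + 1) n
    obtain ⟨ψ⟩ := h.cancel_pow n (M × (Fin (k + 1) → R)) PUnit.{u + 1}
      ((LinearEquiv.prodAssoc Rᵐᵒᵖ M _ _).trans
        (((LinearEquiv.refl Rᵐᵒᵖ M).prodCongr σ.symm).trans
          ((LinearEquiv.prodComm Rᵐᵒᵖ M _).trans
            (φ.symm.trans (LinearEquiv.uniqueProd (R := Rᵐᵒᵖ)).symm))))
    have : Subsingleton (M × (Fin (k + 1) → R)) := ψ.injective.subsingleton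
    have h01 := Subsingleton.elim ((0 : M), (0 : Fin (k + 1) → R)) (0, 1)
    exact zero_ne_one (congrFun (congrArg Prod.snd h01) 0)

theorem IsHermiteRing.isStablyFinite (h : IsHermiteRing R) : IsStablyFinite R := by
  intro n hn M _ _ hφ
  obtain ⟨-, ⟨ψ⟩⟩ := h n n hn hn M hφ
  rw [Nat.sub_self] at ψ
  exact ψ.injective.subsingleton

/-- Left multiplication by `a` is a surjection split by left multiplication by `b`, so `R ≅ R ⊕
ker`. The kernel, which contains `1 - b a`, must vanish. -/
theorem IsStablyFinite.isDirectlyFinite (h : IsStablyFinite R) : IsDirectlyFinite R := by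
  intro a b hab
  let l : R →ₗ[Rᵐᵒᵖ] R :=
    { toFun := fun r => a * r
      map_add' := mul_add a
      map_smul' := fun c r => by simp [mul_assoc] }
  have hl : ∀ r, l r = a * r := fun _ => rfl
  let φ : R ≃ₗ[Rᵐᵒᵖ] R × LinearMap.ker l :=
    { toFun := fun r => (a * r, ⟨r - b * (a * r), by
        rw [LinearMap.mem_ker, hl, mul_sub, ← mul_assoc a b, hab, one_mul, sub_self]⟩)
      invFun := fun q => b * q.1 + q.2
      left_inv := fun r => by simp
      right_inv := fun q => by
        obtain ⟨x, y, hy⟩ := q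
        rw [LinearMap.mem_ker, hl] at hy
        have : a * (b * x + y) = x := by rw [mul_add, ← mul_assoc, hab, hy, one_mul, add_zero]
        ext <;> simp [this]
      map_add' := fun r s => by
        ext
        · simp [mul_add]
        · simp only [mul_add, Prod.snd_add, Submodule.coe_add]; abel
      map_smul' := fun c r => by
        ext
        · simp [mul_assoc]
        · simp [mul_assoc, sub_mul] }
  have hone : Nonempty ((Fin 1 → R) ≃ₗ[Rᵐᵒᵖ] (Fin 1 → R) × LinearMap.ker l) :=
    ⟨(LinearEquiv.funUnique (Fin 1) Rᵐᵒᵖ R).trans (φ.trans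
      ((LinearEquiv.funUnique (Fin 1) Rᵐᵒᵖ R).symm.prodCongr (LinearEquiv.refl Rᵐᵒᵖ _)))⟩
  have hs := h 1 one_pos _ hone
  have hk : (1 - b * a) ∈ LinearMap.ker l := by
    rw [LinearMap.mem_ker, hl, mul_sub, ← mul_assoc, hab, one_mul, mul_one, sub_self]
  have := congrArg Subtype.val (Subsingleton.elim (⟨_, hk⟩ : LinearMap.ker l) 0)
  exact (sub_eq_zero.mp this).symm

end CancellationGeneral

/-! ### Cancellation for rings with a full family of orthogonal principal corners -/

section Corners

open MulOpposite

universe u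

/-- An identification of the corner `e R e` with a commutative ring `A`. -/
structure CornerIso (A : Type*) (R : Type*) [CommRing A] [Ring R] (e : R) where
  /-- the underlying additive map -/
  hom : A →+ R
  map_mul' : ∀ a b, hom (a * b) = hom a * hom b
  map_one' : hom 1 = e
  injective' : Function.Injective hom
  surjective' : ∀ r, ∃ a, hom a = e * r * e

namespace CornerIso

variable {A : Type*} {R : Type*} [CommRing A] [Ring R] {e : R} (f : CornerIso A R e)

theorem mul_idem (a : A) : f.hom a * e = f.hom a := by
  have h := f.map_mul' a 1
  rw [mul_one, f.map_one'] at h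
  exact h.symm

theorem idem_mul (a : A) : e * f.hom a = f.hom a := by
  have h := f.map_mul' 1 a
  rw [one_mul, f.map_one'] at h
  exact h.symm

/-- The additive group `P e` for a right `R`-module `P` and an idempotent `e`. -/
def part (_f : CornerIso A R e) (P : Type*) [AddCommGroup P] [Module Rᵐᵒᵖ P] : AddSubgroup P where
  carrier := {p | op e • p = p}
  zero_mem' := smul_zero _
  add_mem' := fun {a b} (ha : _ = _) (hb : _ = _) => by
    rw [Set.mem_ofPred_eq, smul_add, ha, hb]
  neg_mem' := fun {a} (ha : _ = _) => by rw [Set.mem_ofPred_eq, smul_neg, ha]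

variable (P Q : Type*) [AddCommGroup P] [Module Rᵐᵒᵖ P] [AddCommGroup Q] [Module Rᵐᵒᵖ Q]

theorem mem_part {p : P} : p ∈ f.part P ↔ op e • p = p := Iff.rfl

/-- Commutativity of `A` is what turns the right action of `e R e` into a left `A`-module structure.
-/
instance : Module A (f.part P) where
  smul a p := ⟨op (f.hom a) • p.1, by rw [mem_part, smul_smul, ← op_mul, f.mul_idem]⟩
  one_smul p := Subtype.ext (by
    change op (f.hom 1) • p.1 = p.1
    rw [f.map_one']; exact p.2)
  mul_smul a b p := Subtype.ext (by
    change op (f.hom (a * b)) • p.1 = op (f.hom a) • op (f.hom b) • p.1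
    rw [smul_smul, ← op_mul, mul_comm, f.map_mul'])
  smul_zero a := Subtype.ext (smul_zero (op (f.hom a)))
  smul_add a p q := Subtype.ext (smul_add (op (f.hom a)) p.1 q.1)
  add_smul a b p := Subtype.ext (by
    change op (f.hom (a + b)) • p.1 = op (f.hom a) • p.1 + op (f.hom b) • p.1
    rw [map_add, op_add, add_smul])
  zero_smul p := Subtype.ext (by
    change op (f.hom 0) • p.1 = 0
    rw [map_zero, op_zero, zero_smul])

theorem coe_smul_part (a : A) (p : f.part P) : ((a • p : f.part P) : P) = op (f.hom a) • p.1 :=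
  rfl

variable {P Q} in
/-- `P ↦ P e` on isomorphisms. -/
def partCongr (φ : P ≃ₗ[Rᵐᵒᵖ] Q) : f.part P ≃ₗ[A] f.part Q where
  toFun p := ⟨φ p.1, by rw [mem_part, ← map_smul, (f.mem_part P).mp p.2]⟩
  invFun q := ⟨φ.symm q.1, by rw [mem_part, ← map_smul, (f.mem_part Q).mp q.2]⟩
  left_inv p := Subtype.ext (φ.symm_apply_apply _)
  right_inv p := Subtype.ext (φ.apply_symm_apply _)
  map_add' p q := Subtype.ext (map_add φ _ _)
  map_smul' a p := Subtype.ext (map_smul φ _ _)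

/-- `P ↦ P e` preserves products. -/
def partProd : f.part (P × Q) ≃ₗ[A] f.part P × f.part Q where
  toFun p := (⟨p.1.1, congrArg Prod.fst p.2⟩, ⟨p.1.2, congrArg Prod.snd p.2⟩)
  invFun q := ⟨(q.1.1, q.2.1), Prod.ext q.1.2 q.2.2⟩
  left_inv _ := rfl
  right_inv _ := rfl
  map_add' _ _ := rfl
  map_smul' _ _ := rfl

variable {ι : Type*} [Finite ι] (x y : ι → R) (hx : ∀ i, x i * e = x i)
  (hy : ∀ i, e * y i = y i) (hxy : ∀ r, r * e = ∑ᶠ i, x i * (y i * r * e))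

include hx hy hxy in
-- The `x i`, `y i` act as a dual basis of `R e` over `A`: if the `p` generate `P`, the `p x i`
-- generate `P e`, because `p r e = ∑ (p x i)(y i r e)` with `y i r e` in `e R e`.
theorem finite_part [Module.Finite Rᵐᵒᵖ P] : Module.Finite A (f.part P) := by
  have := Fintype.ofFinite ι
  simp_rw [finsum_eq_sum_of_fintype] at hxy
  obtain ⟨s, hs⟩ := Module.Finite.fg_top (R := Rᵐᵒᵖ) (M := P)
  let g : s × ι → f.part P := fun k => ⟨op (x k.2) • k.1.1, by
    rw [mem_part, smul_smul, ← op_mul, hx]⟩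
  have key : ∀ p : P, ∀ hp : op e • p ∈ f.part P,
      (⟨op e • p, hp⟩ : f.part P) ∈ Submodule.span A (Set.range g) := by
    -- With `r` arbitrary, the scalar step of the span induction is absorbed into `r`.
    have main : ∀ p : P, ∀ r : R, ∃ q ∈ Submodule.span A (Set.range g), q.1 = op (r * e) • p := by
      intro p
      have hp : p ∈ Submodule.span Rᵐᵒᵖ (s : Set P) := hs ▸ Submodule.mem_top
      induction hp using Submodule.span_induction with
      | mem p hp =>
        intro r
        choose a ha using fun i => f.surjective' (y i * r)
        refine ⟨∑ i, a i • g (⟨p, hp⟩, i), Submodule.sum_mem _ fun i _ =>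
          Submodule.smul_mem _ _ (Submodule.subset_span ⟨_, rfl⟩), ?_⟩
        rw [AddSubgroup.val_finsetSum, hxy r, Finset.op_sum, Finset.sum_smul]
        refine Finset.sum_congr rfl fun i _ => ?_
        rw [coe_smul_part, ha, smul_smul, ← op_mul, ← mul_assoc e, hy]
      | zero => exact fun r => ⟨0, zero_mem _, (smul_zero _).symm⟩
      | add p q _ _ hp hq =>
        intro r
        obtain ⟨p', hp', hp''⟩ := hp r
        obtain ⟨q', hq', hq''⟩ := hq r
        exact ⟨p' + q', add_mem hp' hq', by rw [smul_add, ← hp'', ← hq'']; rfl⟩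
      | smul c p _ hp =>
        intro r
        obtain ⟨p', hp', hp''⟩ := hp (unop c * r)
        exact ⟨p', hp', by rw [hp'', smul_smul, mul_assoc, op_mul (unop c), op_unop]⟩
    intro p hp
    obtain ⟨q, hq, hq'⟩ := main p 1
    rw [one_mul] at hq'
    convert hq
    exact hq'.symm
  have : Submodule.span A (Set.range g) = ⊤ := by
    refine eq_top_iff.mpr fun p _ => ?_
    have h := key p.1 (by rw [p.2]; exact p.2)
    convert h
    exact p.2.symm
  exact ⟨⟨(Set.finite_range g).toFinset, by simpa using this⟩⟩

include hy hxy in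
-- A projective module embeds in a free one, so it suffices to treat `R e`. There `r = ∑ x i (y i
-- r)` with `y i r` in the domain `A`, and `r a = 0` kills each `y i r`.
theorem isTorsionFree_part [IsDomain A] [Module.Projective Rᵐᵒᵖ P] :
    Module.IsTorsionFree A (f.part P) := by
  have := Fintype.ofFinite ι
  simp_rw [finsum_eq_sum_of_fintype] at hxy
  have base : ∀ (a : A) (r : R), a ≠ 0 → r * f.hom a = 0 → r * e = r → r = 0 := by
    intro a r ha h hr
    rw [← hr, hxy]
    refine Finset.sum_eq_zero fun i _ => ?_
    obtain ⟨b, hb⟩ := f.surjective' (y i * r)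
    rw [← mul_assoc e, hy] at hb
    have : f.hom (b * a) = f.hom 0 := by
      rw [f.map_mul', hb, mul_assoc, f.idem_mul, mul_assoc, h, mul_zero, map_zero]
    have hb0 : b = 0 := (mul_eq_zero.mp (f.injective' this)).resolve_right ha
    rw [← hb, hb0, map_zero, mul_zero]
  refine .of_smul_eq_zero fun a p h => or_iff_not_imp_left.mpr fun ha => ?_
  obtain ⟨σ, hσ⟩ := Module.Projective.out (R := Rᵐᵒᵖ) (P := P)
  have h' : op (f.hom a) • p.1 = 0 := congrArg Subtype.val h
  have hp : σ p.1 = 0 := by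
    ext q
    have h1 : op (f.hom a) • σ p.1 = 0 := by rw [← map_smul, h', map_zero]
    have h2 : op e • σ p.1 = σ p.1 := by rw [← map_smul, (f.mem_part P).mp p.2]
    have h1' := DFunLike.congr_fun h1 q
    have h2' := DFunLike.congr_fun h2 q
    rw [Finsupp.smul_apply, smul_eq_mul] at h1' h2'
    exact congrArg op (base a (unop (σ p.1 q)) ha (congrArg unop h1') (congrArg unop h2'))
  refine Subtype.ext ?_
  rw [← hσ p.1, hp, map_zero]
  rfl

include hx hy hxy in
-- Finitely generated torsion-free modules over a principal ideal domain are free, and the finite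
-- rank of `R e` cancels.
theorem nonempty_part_equiv [IsDomain A] [IsPrincipalIdealRing A]
    [Module.Finite Rᵐᵒᵖ P] [Module.Projective Rᵐᵒᵖ P]
    [Module.Finite Rᵐᵒᵖ Q] [Module.Projective Rᵐᵒᵖ Q]
    (φ : (P × R) ≃ₗ[Rᵐᵒᵖ] (Q × R)) : Nonempty (f.part P ≃ₗ[A] f.part Q) := by
  have := f.finite_part P x y hx hy hxy
  have := f.finite_part Q x y hx hy hxy
  have := f.finite_part R x y hx hy hxy
  have := f.isTorsionFree_part P x y hy hxy
  have := f.isTorsionFree_part Q x y hy hxy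
  have := f.isTorsionFree_part R x y hy hxy
  have h := ((f.partProd P R).symm.trans
    ((f.partCongr φ).trans (f.partProd Q R))).finrank_eq
  rw [Module.finrank_prod, Module.finrank_prod] at h
  exact ⟨LinearEquiv.ofFinrankEq _ _ (Nat.add_right_cancel h)⟩

end CornerIso

/-- The ring `R` has cancellation of projectives if it is generated as an ideal by pairwise
orthogonal idempotents `e t` with `e s R e t = 0` for `s ≠ t` and with corners `e t R e t` that are
principal ideal domains. -/
theorem hasCancellationOfProjectives_of_corners {R : Type u} [Ring R] {T ι : Type*}
    [Fintype ι] (e : T → R) (horth : ∀ s t, s ≠ t → ∀ r, e s * r * e t = 0)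
    (x y : ι → R) (τ : ι → T) (hx : ∀ i, x i * e (τ i) = x i) (hy : ∀ i, e (τ i) * y i = y i)
    (hxy : ∑ i, x i * y i = 1)
    (A : T → Type*) [∀ t, CommRing (A t)] [∀ t, IsDomain (A t)] [∀ t, IsPrincipalIdealRing (A t)]
    (f : ∀ t, CornerIso (A t) R (e t)) : HasCancellationOfProjectives R := by
  classical
  intro P Q _ _ _ _ _ _ _ _ ⟨φ⟩
  have hpart : ∀ t, Nonempty ((f t).part P ≃ₗ[A t] (f t).part Q) := by
    intro t
    refine (f t).nonempty_part_equiv P Q (ι := {i // τ i = t}) (fun i => x i) (fun i => y i)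
      (fun i => by have := hx i; rwa [i.2] at this)
      (fun i => by have := hy i; rwa [i.2] at this) (fun r => ?_) φ
    rw [finsum_eq_sum_of_fintype]
    calc r * e t = ∑ i, x i * (y i * r * e t) := by
          simp_rw [mul_assoc, ← mul_assoc (x _), ← Finset.sum_mul, hxy, one_mul]
      -- Since `y i = e (τ i) y i`, the terms with `τ i ≠ t` lie in `x i · e (τ i) R e t = 0`.
      _ = ∑ i with τ i = t, x i * (y i * r * e t) := by
          refine (Finset.sum_filter_of_ne fun i _ hne => ?_).symm
          by_contra hi
          exact hne (by rw [← hy i, mul_assoc (e _), horth _ _ hi, mul_zero])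
      _ = _ := Finset.sum_subtype _ (by simp) _
  let ψ := fun t => (hpart t).some
  -- gluing of the isomorphisms on the corners
  have glue : ∀ (P' Q' : Type u) [AddCommGroup P'] [Module Rᵐᵒᵖ P'] [AddCommGroup Q']
      [Module Rᵐᵒᵖ Q'] (χ : ∀ t, (f t).part P' ≃ₗ[A t] (f t).part Q'),
      ∃ Φ : P' →ₗ[Rᵐᵒᵖ] Q', ∀ t (p : (f t).part P'), Φ p.1 = (χ t p).1 := by
    intro P' Q' _ _ _ _ χ
    have hm : ∀ (i : ι) (p : P'), op (x i) • p ∈ (f (τ i)).part P' := fun i p => by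
      rw [CornerIso.mem_part, smul_smul, ← op_mul, hx]
    -- The family `χ` commutes with right multiplication by `e t R e s`: these elements are scalars
    -- from `A t` when `s = t`, and zero otherwise.
    have hlin : ∀ t (r : R) (p : (f t).part P') (s : T) (h : op (r * e s) • p.1 ∈ (f s).part P'),
        (χ s ⟨op (r * e s) • p.1, h⟩).1 = op (r * e s) • (χ t p).1 := by
      intro t r p s h
      have hp : ∀ (N : Type u) [AddCommGroup N] [Module Rᵐᵒᵖ N] (q : (f t).part N),
          op (r * e s) • q.1 = op (e t * r * e s) • q.1 := fun N _ _ q => by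
        rw [mul_assoc, op_mul (e t), ← smul_smul, ((f t).mem_part N).mp q.2]
      by_cases hst : t = s
      · subst hst
        obtain ⟨a, ha⟩ := (f t).surjective' r
        have h1 : (⟨op (r * e t) • p.1, h⟩ : (f t).part P') = a • p := by
          refine Subtype.ext ((hp P' p).trans ?_)
          rw [CornerIso.coe_smul_part, ha]
        rw [h1, map_smul, CornerIso.coe_smul_part, ha, hp]
      · have h1 : (⟨op (r * e s) • p.1, h⟩ : (f s).part P') = 0 := by
          refine Subtype.ext ((hp P' p).trans ?_)
          rw [horth _ _ hst, op_zero, zero_smul]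
          rfl
        rw [h1, map_zero, hp, horth _ _ hst, op_zero, zero_smul]
        rfl
    have hdec : ∀ (N : Type u) [AddCommGroup N] [Module Rᵐᵒᵖ N] (p : N),
        p = ∑ i, op (y i) • op (x i) • p := fun N _ _ p => by
      simp_rw [smul_smul, ← op_mul, ← Finset.sum_smul, ← Finset.op_sum, hxy, op_one, one_smul]
    -- The formula is forced by `p = ∑ (p x i) y i`, in which `p x i` lies in the corner part at `τ
    -- i`.
    let Φ₀ : P' →+ Q' :=
      { toFun := fun p => ∑ i, op (y i) • (χ (τ i) ⟨op (x i) • p, hm i p⟩).1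
        map_zero' := Finset.sum_eq_zero fun i _ => by
          have : (⟨op (x i) • (0 : P'), hm i 0⟩ : (f (τ i)).part P') = 0 :=
            Subtype.ext (smul_zero _)
          rw [this, map_zero]
          exact smul_zero _
        map_add' := fun p q => by
          rw [← Finset.sum_add_distrib]
          refine Finset.sum_congr rfl fun i _ => ?_
          have : (⟨op (x i) • (p + q), hm i _⟩ : (f (τ i)).part P') =
              ⟨op (x i) • p, hm i p⟩ + ⟨op (x i) • q, hm i q⟩ := Subtype.ext (smul_add _ _ _)
          rw [this, map_add, ← smul_add]
          rfl }
    have hΦ₀ : ∀ p, Φ₀ p = ∑ i, op (y i) • (χ (τ i) ⟨op (x i) • p, hm i p⟩).1 := fun _ => rfl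
    have hpart : ∀ (r : R) t (p : (f t).part P'), Φ₀ (op r • p.1) = op r • (χ t p).1 := by
      intro r t p
      rw [hΦ₀, hdec Q' (op r • _)]
      refine Finset.sum_congr rfl fun i _ => ?_
      have h := hlin t (r * x i) p (τ i) (by rw [mul_assoc, hx, op_mul, ← smul_smul]; exact hm _ _)
      simp_rw [mul_assoc, hx, op_mul, ← smul_smul] at h
      rw [h]
    refine ⟨{ Φ₀ with map_smul' := fun c p => ?_ }, fun t p => ?_⟩
    · change Φ₀ (c • p) = c • Φ₀ p
      rw [hΦ₀ p, Finset.smul_sum]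
      conv_lhs => rw [hdec P' p, Finset.smul_sum, map_sum]
      refine Finset.sum_congr rfl fun i _ => ?_
      rw [smul_smul, smul_smul c]
      exact hpart (y i * unop c) (τ i) ⟨op (x i) • p, hm i p⟩
    · have := hpart 1 t p
      rwa [op_one, one_smul, one_smul] at this
  obtain ⟨Φ, hΦ⟩ := glue P Q ψ
  obtain ⟨Ψ, hΨ⟩ := glue Q P fun t => (ψ t).symm
  have inv : ∀ (N N' : Type u) [AddCommGroup N] [Module Rᵐᵒᵖ N] [AddCommGroup N']
      [Module Rᵐᵒᵖ N'] (χ : ∀ t, (f t).part N ≃ₗ[A t] (f t).part N') (F : N →ₗ[Rᵐᵒᵖ] N')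
      (F' : N' →ₗ[Rᵐᵒᵖ] N) (_ : ∀ t (p : (f t).part N), F p.1 = (χ t p).1)
      (_ : ∀ t (p : (f t).part N'), F' p.1 = ((χ t).symm p).1), ∀ p, F' (F p) = p := by
    intro N N' _ _ _ _ χ F F' hF hF' p
    have hdec : p = ∑ i, op (y i) • op (x i) • p := by
      simp_rw [smul_smul, ← op_mul, ← Finset.sum_smul, ← Finset.op_sum, hxy, op_one, one_smul]
    rw [hdec, map_sum, map_sum]
    refine Finset.sum_congr rfl fun i _ => ?_
    have hm : op (x i) • p ∈ (f (τ i)).part N := by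
      rw [CornerIso.mem_part, smul_smul, ← op_mul, hx]
    rw [map_smul, map_smul, hF (τ i) ⟨_, hm⟩, hF', LinearEquiv.symm_apply_apply]
  exact ⟨LinearEquiv.ofLinearMap Φ Ψ
    (LinearMap.ext (inv Q P (fun t => (ψ t).symm) Ψ Φ hΨ (by simpa using hΦ)))
    (LinearMap.ext (inv P Q ψ Φ Ψ hΦ hΨ))⟩

end Corners

/-! ### Reachability in directed graphs -/

namespace DirectedGraph

variable {V E : Type*} (G : DirectedGraph V E)

/-- There is an edge from `u` to `w`. -/
def Step (u w : V) : Prop := ∃ e, G.s e = u ∧ G.r e = w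

/-- There is a path, possibly of length zero, from `u` to `w`. -/
def Reach : V → V → Prop := Relation.ReflTransGen G.Step

variable {G}

theorem Reach.trans {u v w : V} (h : G.Reach u v) (h' : G.Reach v w) : G.Reach u w :=
  Relation.ReflTransGen.trans h h'

theorem reach_edge (e : E) : G.Reach (G.s e) (G.r e) :=
  Relation.ReflTransGen.single ⟨e, rfl, rfl⟩

variable (G)

/-- `l` is the list of edges of a path from `u` to `w`. -/
def Walk : V → List E → V → Prop
  | u, [], w => u = w
  | u, e :: l, w => G.s e = u ∧ Walk (G.r e) l w

/-- A vertex is terminal if it can be reached back from every vertex that it reaches. -/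
def IsTerminal (v : V) : Prop := ∀ w, G.Reach v w → G.Reach w v

variable {G}

theorem Walk.reach {l : List E} : ∀ {u w : V}, G.Walk u l w → G.Reach u w := by
  induction l with
  | nil => rintro u w rfl; exact .refl
  | cons e l ih => rintro u w ⟨rfl, h⟩; exact (reach_edge e).trans (ih h)

theorem walk_append {l l' : List E} : ∀ {u w : V},
    G.Walk u (l ++ l') w ↔ ∃ v, G.Walk u l v ∧ G.Walk v l' w := by
  induction l with
  | nil => intro u w; simp [Walk]
  | cons e l ih => intro u w; simp [Walk, ih, and_assoc]

/-- Loop erasure: if the new source already occurs in the walk, restart from that occurrence.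
Keeping the endpoint off the sources allows an edge out of it to be prepended to close a cycle. -/
theorem Reach.exists_walk {u v : V} (h : G.Reach u v) :
    ∃ l, G.Walk u l v ∧ (l.map G.s).Nodup ∧ v ∉ l.map G.s := by
  induction h using Relation.ReflTransGen.head_induction_on with
  | refl => exact ⟨[], rfl, by simp, by simp⟩
  | @head u u' hstep _ ih =>
    obtain ⟨e, rfl, rfl⟩ := hstep
    obtain ⟨l, hl, hnd, hv⟩ := ih
    by_cases huv : G.s e = v
    · exact ⟨[], huv, by simp, by simp⟩
    by_cases hu : G.s e ∈ l.map G.s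
    · obtain ⟨b, hb, hbe⟩ := List.mem_map.mp hu
      obtain ⟨l₁, l₂, rfl⟩ := List.append_of_mem hb
      obtain ⟨w, -, hw⟩ := walk_append.mp hl
      rw [List.map_append] at hnd hv
      exact ⟨b :: l₂, ⟨hbe, hw.2⟩, (List.nodup_append.mp hnd).2.1,
        fun h => hv (List.mem_append_right _ h)⟩
    · exact ⟨e :: l, ⟨rfl, hl⟩, List.nodup_cons.mpr ⟨hu, hnd⟩,
        fun h => (List.mem_cons.mp h).elim (fun h => huv h.symm) hv⟩

theorem Walk.isChain {e : E} {l : List E} : ∀ {w : V}, G.Walk (G.r e) l w →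
    (e :: l).IsChain (fun e f => G.r e = G.s f) := by
  induction l generalizing e with
  | nil => intro w _; simp
  | cons f l ih => rintro w ⟨h, h'⟩; exact List.isChain_cons_cons.mpr ⟨h.symm, ih h'⟩

theorem Walk.r_getLast {e : E} {l : List E} : ∀ {w : V}, G.Walk (G.r e) l w →
    G.r ((e :: l).getLast (List.cons_ne_nil e l)) = w := by
  induction l generalizing e with
  | nil => exact fun h => h
  | cons f l ih => rintro w ⟨h, h'⟩; rw [List.getLast_cons (List.cons_ne_nil f l)]; exact ih h'

theorem walk_of_isChain {e : E} {l : List E} (h : (e :: l).IsChain (fun e f => G.r e = G.s f)) :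
    G.Walk (G.s e) (e :: l) (G.r ((e :: l).getLast (List.cons_ne_nil e l))) := by
  induction l generalizing e with
  | nil => exact ⟨rfl, rfl⟩
  | cons f l ih =>
    rw [List.isChain_cons_cons] at h
    refine ⟨rfl, ?_⟩
    rw [h.1, List.getLast_cons (List.cons_ne_nil f l)]
    exact ih h.2

/-- An edge that can be followed back to its source is the first edge of a cycle. -/
theorem exists_isCycle {e : E} (h : G.Reach (G.r e) (G.s e)) : ∃ l, G.IsCycle (e :: l) := by
  obtain ⟨l, hl, hnd, hv⟩ := h.exists_walk
  exact ⟨l, ⟨List.cons_ne_nil e l, hl.isChain⟩, fun _ => hl.r_getLast, List.nodup_cons.mpr ⟨hv, hnd⟩⟩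

theorem IsCycle.reach {p : List E} (h : G.IsCycle p) {e : E} (he : e ∈ p) :
    G.Reach (G.r e) (G.s e) := by
  obtain ⟨⟨hp, hc⟩, hcl, -⟩ := h
  obtain ⟨f, l, rfl⟩ := List.exists_cons_of_ne_nil hp
  have hw := walk_of_isChain hc
  rw [hcl hp, List.head_cons] at hw
  obtain ⟨l₁, l₂, hl⟩ := List.append_of_mem he
  rw [hl] at hw
  obtain ⟨v, hv, rfl, hv'⟩ := walk_append.mp hw
  exact hv'.reach.trans hv.reach

theorem NoExit.eq_of_reach (hG : G.NoExit) {e f : E} (h : G.Reach (G.r e) (G.s e))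
    (hf : G.s f = G.s e) : f = e := by
  obtain ⟨l, hl⟩ := exists_isCycle h
  by_contra hne
  exact hG _ hl f ⟨e, List.mem_cons_self, hf, hne⟩

theorem IsTerminal.of_reach {v w : V} (hv : G.IsTerminal v) (h : G.Reach v w) : G.IsTerminal w :=
  fun _ hu => (hv _ (h.trans hu)).trans h

theorem IsTerminal.range {e : E} (h : G.IsTerminal (G.s e)) : G.IsTerminal (G.r e) :=
  h.of_reach (reach_edge e)

theorem IsTerminal.reach_range {e : E} (h : G.IsTerminal (G.s e)) : G.Reach (G.r e) (G.s e) :=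
  h _ (reach_edge e)

theorem NoExit.eq_of_isTerminal (hG : G.NoExit) {e f : E} (h : G.IsTerminal (G.s e))
    (hf : G.s f = G.s e) : f = e :=
  hG.eq_of_reach h.reach_range hf

/-- In a graph without exits, a vertex on a cycle is terminal. -/
theorem NoExit.isTerminal_of_reach (hG : G.NoExit) {e : E} (h : G.Reach (G.r e) (G.s e)) :
    G.IsTerminal (G.s e) := by
  -- Every vertex reached still emits an edge that leads back to it; without exits this is its only
  -- edge, so no path can escape.
  have key : ∀ w, G.Reach (G.s e) w → G.Reach w (G.s e) ∧
      ∃ f, G.s f = w ∧ G.Reach (G.r f) w := by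
    intro w hw
    induction hw with
    | refl => exact ⟨.refl, e, rfl, h⟩
    | tail _ hstep ih =>
      obtain ⟨f, rfl, rfl⟩ := hstep
      obtain ⟨hback, f', hf', hreach⟩ := ih
      rw [← hf'] at hreach
      obtain rfl := hG.eq_of_reach hreach hf'.symm
      have hback' := hreach.trans hback
      refine ⟨hback', ?_⟩
      -- The edge required at `r(f)` is `f` itself if `f` is a loop, and otherwise the first edge of
      -- the way back.
      rcases Relation.ReflTransGen.cases_head hreach with heq | ⟨u, ⟨g, hg, rfl⟩, hu⟩
      · exact ⟨f, heq.symm, .refl⟩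
      · exact ⟨g, hg, Relation.ReflTransGen.trans hu (reach_edge f)⟩
  exact fun w hw => (key w hw).1

/-- In a finite graph without exits, a property of vertices holds if it holds for the terminal ones
and passes from the ranges of the edges out of a non-terminal vertex to that vertex. -/
theorem NoExit.induction [Finite V] (hG : G.NoExit) {p : V → Prop}
    (hterm : ∀ v, G.IsTerminal v → p v)
    (hstep : ∀ v, (∃ e, G.s e = v) → (∀ e, G.s e = v → p (G.r e)) → p v) (v : V) : p v := by
  -- The number of reachable vertices drops strictly along an edge out of a non-terminal vertex: if
  -- the range still reached the source, the source would lie on a cycle and be terminal.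
  induction hn : Set.ncard {w | G.Reach v w} using Nat.strong_induction_on generalizing v with
  | _ n ih =>
    by_cases hv : G.IsTerminal v
    · exact hterm v hv
    have hedge : ∃ e, G.s e = v := by
      by_contra hno
      refine hv fun w hw => ?_
      rcases Relation.ReflTransGen.cases_head hw with rfl | ⟨u, ⟨e, he, -⟩, -⟩
      · exact .refl
      · exact absurd ⟨e, he⟩ hno
    refine hstep v hedge fun e he => ih _ ?_ _ rfl
    subst he
    rw [← hn]
    refine Set.ncard_lt_ncard ⟨fun w hw => (reach_edge e).trans hw, fun hsub => ?_⟩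
      (Set.toFinite _)
    exact hv (hG.isTerminal_of_reach (hsub (Relation.ReflTransGen.refl : G.Reach _ _)))

variable (G)

/-- Mutual reachability of vertices. -/
def reachSetoid : Setoid V where
  r u v := G.Reach u v ∧ G.Reach v u
  iseqv := ⟨fun _ => ⟨.refl, .refl⟩, fun h => ⟨h.2, h.1⟩,
    fun h h' => ⟨h.1.trans h'.1, h'.2.trans h.2⟩⟩

/-- The terminal classes of mutually reachable vertices. -/
def TerminalClass : Type _ := {q : Quotient G.reachSetoid // G.IsTerminal q.out}

variable {G}

/-- A representative of a terminal class. -/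
noncomputable def TerminalClass.rep (q : G.TerminalClass) : V := q.1.out

theorem IsTerminal.exists_rep {v : V} (hv : G.IsTerminal v) :
    ∃ q : G.TerminalClass, G.Reach v q.rep := by
  have h : G.reachSetoid (Quotient.mk G.reachSetoid v).out v := Quotient.exact (Quotient.out_eq _)
  exact ⟨⟨_, hv.of_reach h.2⟩, h.2⟩

theorem TerminalClass.not_reach {q q' : G.TerminalClass} (h : q ≠ q') :
    ¬ G.Reach q'.rep q.rep := fun hr =>
  h (Subtype.ext (Quotient.out_equiv_out.mp ⟨q'.2 _ hr, hr⟩))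

variable (G) in
/-- A coding of the pairs of an edge and a number by pairs of a vertex and a number. -/
theorem exists_coding [Finite E] : ∃ β : E → ℕ → ℕ,
    (∀ e f m n, G.s e = G.s f → β e m = β f n → e = f ∧ m = n) ∧
      ∀ e n, ∃ f m, G.s f = G.s e ∧ β f m = n := by
  -- The edges out of an emitting vertex form a finite nonempty set, whose product with `ℕ` is
  -- countably infinite.
  have h : ∀ v : Set.range G.s, Nonempty (({e // G.s e = v} × ℕ) ≃ ℕ) := by
    rintro ⟨_, e, rfl⟩
    have : Nonempty {f // G.s f = G.s e} := ⟨e, rfl⟩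
    exact nonempty_equiv_of_countable
  let φ := fun v => (h v).some
  have hφ : ∀ (v w : Set.range G.s) (hvw : v = w) (a : {e // G.s e = v} × ℕ)
      (b : {e // G.s e = w} × ℕ), φ v a = φ w b → a.1.1 = b.1.1 ∧ a.2 = b.2 := by
    rintro v _ rfl a b hab
    rw [(φ v).injective hab]
    exact ⟨rfl, rfl⟩
  refine ⟨fun e m => φ ⟨G.s e, e, rfl⟩ (⟨e, rfl⟩, m), fun e f m n hs hβ =>
    hφ _ _ (Subtype.ext hs) _ _ hβ, fun e n => ?_⟩
  obtain ⟨⟨⟨f, hf⟩, m⟩, ha⟩ := (φ ⟨G.s e, e, rfl⟩).surjective n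
  refine ⟨f, m, hf, ?_⟩
  rw [← ha]
  have : ∀ (v w : Set.range G.s) (hvw : v = w) (hv : G.s f = v) (hw : G.s f = w),
      φ v (⟨f, hv⟩, m) = φ w (⟨f, hw⟩, m) := by
    rintro v _ rfl _ _; rfl
  exact this _ _ (Subtype.ext hf) _ _

end DirectedGraph

/-! ### The Leavitt path algebra: generators, universal property, grading -/

namespace LeavittPathAlgebra

open LaurentPolynomial

variable (K : Type*) [Field K] {V E : Type*} [Fintype V] [Fintype E] [DecidableEq V]
  (G : DirectedGraph V E)

/-- The quotient map from the free algebra. -/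
noncomputable def ofFree : FreeAlgebra K (LeavittGen V E) →ₐ[K] LeavittPathAlgebra K G :=
  (RingQuot.mkAlgHom K (LeavittRel K G) :)

theorem ofFree_surjective : Function.Surjective (ofFree K G) :=
  RingQuot.mkAlgHom_surjective K (LeavittRel K G)

variable {K G} in
theorem ofFree_rel {a b : FreeAlgebra K (LeavittGen V E)} (h : LeavittRel K G a b) :
    ofFree K G a = ofFree K G b :=
  RingQuot.mkAlgHom_rel K h

/-- The vertex `v` in the Leavitt path algebra. -/
noncomputable def vertex (v : V) : LeavittPathAlgebra K G := ofFree K G (LeavittGen.vert K E v)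

/-- The edge `e` in the Leavitt path algebra. -/
noncomputable def edge (e : E) : LeavittPathAlgebra K G := ofFree K G (LeavittGen.edg K V e)

/-- The ghost edge `e*` in the Leavitt path algebra. -/
noncomputable def ghost (e : E) : LeavittPathAlgebra K G := ofFree K G (LeavittGen.gho K V e)

theorem vertex_mul_self (v : V) : vertex K G v * vertex K G v = vertex K G v := by
  simpa [vertex] using ofFree_rel (LeavittRel.vertex_mul_self v)

theorem vertex_mul_of_ne {v w : V} (h : v ≠ w) : vertex K G v * vertex K G w = 0 := by
  simpa [vertex] using ofFree_rel (LeavittRel.vertex_mul_of_ne (K := K) (G := G) v w h)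

theorem source_mul_edge (e : E) : vertex K G (G.s e) * edge K G e = edge K G e := by
  simpa [vertex, edge] using ofFree_rel (LeavittRel.source_mul_edge e)

theorem edge_mul_range (e : E) : edge K G e * vertex K G (G.r e) = edge K G e := by
  simpa [vertex, edge] using ofFree_rel (LeavittRel.edge_mul_range e)

theorem range_mul_ghost (e : E) : vertex K G (G.r e) * ghost K G e = ghost K G e := by
  simpa [vertex, ghost] using ofFree_rel (LeavittRel.range_mul_ghost e)

theorem ghost_mul_source (e : E) : ghost K G e * vertex K G (G.s e) = ghost K G e := by
  simpa [vertex, ghost] using ofFree_rel (LeavittRel.ghost_mul_source e)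

theorem ghost_mul_edge_self (e : E) : ghost K G e * edge K G e = vertex K G (G.r e) := by
  simpa [vertex, ghost, edge] using ofFree_rel (LeavittRel.ghost_mul_edge_self (K := K) (G := G) e)

theorem ghost_mul_edge_of_ne {e f : E} (h : e ≠ f) : ghost K G e * edge K G f = 0 := by
  simpa [ghost, edge] using ofFree_rel (LeavittRel.ghost_mul_edge_of_ne (K := K) (G := G) e f h)

theorem vertex_eq_sum {v : V} (h : ∃ e, G.s e = v) :
    vertex K G v = ∑ e with G.s e = v, edge K G e * ghost K G e := by
  simpa [vertex, ghost, edge] using ofFree_rel (LeavittRel.vertex_eq_sum (K := K) (G := G) v h)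

theorem one_eq_sum : (1 : LeavittPathAlgebra K G) = ∑ v, vertex K G v := by
  simpa [vertex] using ofFree_rel (LeavittRel.one_eq_sum (K := K) (G := G))

variable {K G} in
/-- Induction on the elements of the Leavitt path algebra. -/
theorem induction {p : LeavittPathAlgebra K G → Prop}
    (hscalar : ∀ a : K, p (algebraMap K _ a)) (hvertex : ∀ v, p (vertex K G v))
    (hedge : ∀ e, p (edge K G e)) (hghost : ∀ e, p (ghost K G e))
    (hadd : ∀ a b, p a → p b → p (a + b)) (hmul : ∀ a b, p a → p b → p (a * b))
    (a : LeavittPathAlgebra K G) : p a := by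
  obtain ⟨a, rfl⟩ := ofFree_surjective K G a
  induction a using FreeAlgebra.induction with
  | grade0 r => rw [AlgHom.commutes]; exact hscalar r
  | grade1 g =>
    cases g with
    | vertex v => exact hvertex v
    | edge e => exact hedge e
    | ghost e => exact hghost e
  | mul a b ha hb => rw [map_mul]; exact hmul _ _ ha hb
  | add a b ha hb => rw [map_add]; exact hadd _ _ ha hb

variable {K} in
/-- A family of elements of an algebra that satisfies the relations of the Leavitt path algebra. -/
structure Family {B : Type*} [Ring B] [Algebra K B] (pv : V → B) (pe pg : E → B) : Prop where
  vertex_mul_self : ∀ v, pv v * pv v = pv v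
  vertex_mul_of_ne : ∀ v w, v ≠ w → pv v * pv w = 0
  source_mul_edge : ∀ e, pv (G.s e) * pe e = pe e
  edge_mul_range : ∀ e, pe e * pv (G.r e) = pe e
  range_mul_ghost : ∀ e, pv (G.r e) * pg e = pg e
  ghost_mul_source : ∀ e, pg e * pv (G.s e) = pg e
  ghost_mul_edge_self : ∀ e, pg e * pe e = pv (G.r e)
  ghost_mul_edge_of_ne : ∀ e f, e ≠ f → pg e * pe f = 0
  vertex_eq_sum : ∀ v, (∃ e, G.s e = v) → pv v = ∑ e with G.s e = v, pe e * pg e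
  one_eq_sum : 1 = ∑ v, pv v

variable {K G}

/-- The map on generators given by a family of elements. -/
def genMap {B : Type*} (pv : V → B) (pe pg : E → B) : LeavittGen V E → B
  | .vertex v => pv v
  | .edge e => pe e
  | .ghost e => pg e

theorem Family.exists_hom {B : Type*} [Ring B] [Algebra K B] {pv : V → B} {pe pg : E → B}
    (F : Family (K := K) G pv pe pg) : ∃ φ : LeavittPathAlgebra K G →ₐ[K] B,
      (∀ v, φ (vertex K G v) = pv v) ∧ (∀ e, φ (edge K G e) = pe e) ∧
        ∀ e, φ (ghost K G e) = pg e := by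
  let ψ : FreeAlgebra K (LeavittGen V E) →ₐ[K] B := FreeAlgebra.lift K (genMap pv pe pg)
  have hv : ∀ v, ψ (LeavittGen.vert K E v) = pv v := fun v => FreeAlgebra.lift_ι_apply _ _
  have he : ∀ e, ψ (LeavittGen.edg K V e) = pe e := fun e => FreeAlgebra.lift_ι_apply _ _
  have hg : ∀ e, ψ (LeavittGen.gho K V e) = pg e := fun e => FreeAlgebra.lift_ι_apply _ _
  have hrel : ∀ ⦃a b⦄, LeavittRel K G a b → ψ a = ψ b := by
    intro a b h
    cases h with
    | vertex_mul_self v => rw [map_mul, hv, F.vertex_mul_self]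
    | vertex_mul_of_ne v w h => rw [map_mul, hv, hv, F.vertex_mul_of_ne v w h, map_zero]
    | source_mul_edge e => rw [map_mul, hv, he, F.source_mul_edge]
    | edge_mul_range e => rw [map_mul, hv, he, F.edge_mul_range]
    | range_mul_ghost e => rw [map_mul, hv, hg, F.range_mul_ghost]
    | ghost_mul_source e => rw [map_mul, hv, hg, F.ghost_mul_source]
    | ghost_mul_edge_self e => rw [map_mul, hv, he, hg, F.ghost_mul_edge_self]
    | ghost_mul_edge_of_ne e f h => rw [map_mul, he, hg, F.ghost_mul_edge_of_ne e f h, map_zero]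
    | vertex_eq_sum v h => simp_rw [map_sum, map_mul, hv, he, hg]; exact F.vertex_eq_sum v h
    | one_eq_sum => simp_rw [map_sum, map_one, hv]; exact F.one_eq_sum
  let φ : LeavittPathAlgebra K G →ₐ[K] B := (RingQuot.liftAlgHom K ⟨ψ, hrel⟩ :)
  have hφ : ∀ a, φ (ofFree K G a) = ψ a := fun a => RingQuot.liftAlgHom_mkAlgHom_apply K ψ hrel a
  exact ⟨φ, fun v => (hφ _).trans (hv v), fun e => (hφ _).trans (he e),
    fun e => (hφ _).trans (hg e)⟩

/-! ### The `ℤ`-grading and the nonvanishing of vertices. -/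

variable (K G)

theorem C_mul_T_mul_C_mul_T {R : Type*} [Semiring R] (a b : R) (m n : ℤ) :
    (C a * T m) * (C b * T n) = C (a * b) * T (m + n) := by
  rw [mul_assoc, ← mul_assoc (T m), T_mul, mul_assoc, ← T_add, ← mul_assoc, ← map_mul]

/-- The `ℤ`-grading of the Leavitt path algebra, as a coaction of `ℤ`. -/
theorem exists_grading : ∃ D : LeavittPathAlgebra K G →ₐ[K] (LeavittPathAlgebra K G)[T;T⁻¹],
    (∀ v, D (vertex K G v) = C (vertex K G v) * T 0) ∧
      (∀ e, D (edge K G e) = C (edge K G e) * T 1) ∧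
        ∀ e, D (ghost K G e) = C (ghost K G e) * T (-1) := by
  refine Family.exists_hom ⟨fun v => ?_, fun v w h => ?_, fun e => ?_, fun e => ?_, fun e => ?_,
    fun e => ?_, fun e => ?_, fun e f h => ?_, fun v h => ?_, ?_⟩
  · rw [C_mul_T_mul_C_mul_T, vertex_mul_self, add_zero]
  · rw [C_mul_T_mul_C_mul_T, vertex_mul_of_ne K G h, map_zero, zero_mul]
  · rw [C_mul_T_mul_C_mul_T, source_mul_edge, zero_add]
  · rw [C_mul_T_mul_C_mul_T, edge_mul_range, add_zero]
  · rw [C_mul_T_mul_C_mul_T, range_mul_ghost, zero_add]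
  · rw [C_mul_T_mul_C_mul_T, ghost_mul_source, add_zero]
  · rw [C_mul_T_mul_C_mul_T, ghost_mul_edge_self, neg_add_cancel]
  · rw [C_mul_T_mul_C_mul_T, ghost_mul_edge_of_ne K G h, map_zero, zero_mul]
  · simp_rw [C_mul_T_mul_C_mul_T, add_neg_cancel, ← Finset.sum_mul, ← map_sum]
    rw [vertex_eq_sum K G h]
  · rw [← Finset.sum_mul, ← map_sum, ← one_eq_sum, map_one, T_zero, one_mul]

/-- A representation on functions on `V × ℕ` detects `v`. Vertices act as projections to their copy
of `ℕ`; an edge `e` carries the copy at `r(e)` onto the piece of the copy at `s(e)` coded by `e`,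
and `e*` undoes this. The pieces partition the copy at each emitting vertex, which is the relation
`v = ∑ e e*`. -/
theorem vertex_ne_zero (v : V) : vertex K G v ≠ 0 := by
  classical
  obtain ⟨β, hinj, hsurj⟩ := G.exists_coding
  let j : E → ℕ → V × ℕ := fun e m => (G.s e, β e m)
  have hj : ∀ e f m n, j e m = j f n → e = f ∧ m = n := fun e f m n h =>
    hinj e f m n (congrArg Prod.fst h) (congrArg Prod.snd h)
  have hji : ∀ e, Function.Injective (j e) := fun e m n h => (hj e e m n h).2
  let pv : V → Module.End K (V × ℕ → K) := fun v =>
    { toFun := fun f x => if x.1 = v then f x else 0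
      map_add' := fun f g => by ext x; simp only [Pi.add_apply]; split_ifs <;> simp
      map_smul' := fun a f => by ext x; simp }
  let pe : E → Module.End K (V × ℕ → K) := fun e =>
    { toFun := fun f => Function.extend (j e) (fun m => f (G.r e, m)) 0
      map_add' := fun f g => by
        rw [← Function.extend_add, add_zero]; rfl
      map_smul' := fun a f => by
        rw [RingHom.id_apply, ← Function.extend_smul, smul_zero]; rfl }
  let pg : E → Module.End K (V × ℕ → K) := fun e =>
    { toFun := fun f x => if x.1 = G.r e then f (j e x.2) else 0
      map_add' := fun f g => by ext x; simp only [Pi.add_apply]; split_ifs <;> simp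
      map_smul' := fun a f => by ext x; simp }
  have hpv : ∀ v f x, pv v f x = if x.1 = v then f x else 0 := fun _ _ _ => rfl
  have hpg : ∀ e f x, pg e f x = if x.1 = G.r e then f (j e x.2) else 0 := fun _ _ _ => rfl
  have hpe : ∀ e f m, pe e f (j e m) = f (G.r e, m) := fun e f m => (hji e).extend_apply (fun m => f (G.r e, m)) 0 m
  have hpe' : ∀ e f x, (¬ ∃ m, j e m = x) → pe e f x = 0 := fun e f x h =>
    Function.extend_apply' (fun m => f (G.r e, m)) (0 : V × ℕ → K) x h
  have hpeg : ∀ e f x, pe e (pg e f) x = if ∃ m, j e m = x then f x else 0 := by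
    intro e f x
    split_ifs with h
    · obtain ⟨m, rfl⟩ := h
      rw [hpe, hpg, if_pos rfl]
    · exact hpe' _ _ _ h
  have F : Family (K := K) G pv pe pg := by
    refine ⟨fun v => ?_, fun v w h => ?_, fun e => ?_, fun e => ?_, fun e => ?_,
      fun e => ?_, fun e => ?_, fun e f h => ?_, fun v h => ?_, ?_⟩ <;>
      refine LinearMap.ext fun g => funext fun x => ?_ <;>
      simp only [Module.End.mul_apply, LinearMap.zero_apply, Pi.zero_apply, LinearMap.sum_apply,
        Finset.sum_apply, Module.End.one_apply]
    · rw [hpv, hpv]; split_ifs <;> rfl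
    · rw [hpv, hpv]
      split_ifs with h₁ h₂
      · exact absurd (h₁.symm.trans h₂) h
      · rfl
      · rfl
    · rw [hpv]
      split_ifs with h
      · rfl
      · exact (hpe' _ _ _ fun ⟨m, hm⟩ => h (congrArg Prod.fst hm).symm).symm
    · by_cases h : ∃ m, j e m = x
      · obtain ⟨m, rfl⟩ := h
        rw [hpe, hpe, hpv, if_pos rfl]
      · rw [hpe' _ _ _ h, hpe' _ _ _ h]
    · rw [hpv, hpg]; split_ifs <;> rfl
    · rw [hpg, hpg, hpv, if_pos rfl]
    · rw [hpg, hpe, hpv]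
      split_ifs with h
      · rw [← h]
      · rfl
    · rw [hpg]
      split_ifs
      · exact hpe' _ _ _ fun ⟨m, hm⟩ => h (hj _ _ _ _ hm).1.symm
      · rfl
    · simp_rw [hpeg]
      rw [hpv]
      split_ifs with hx
      · obtain ⟨e, he⟩ := h
        obtain ⟨f, m, hf, hm⟩ := hsurj e x.2
        have hfm : j f m = x := Prod.ext (hf.trans (he.trans hx.symm)) hm
        rw [Finset.sum_eq_single_of_mem f (by simp [hf, he]), if_pos ⟨m, hfm⟩]
        rintro e' - he'
        exact if_neg fun ⟨m', hm'⟩ => he' (hj _ _ _ _ (hm'.trans hfm.symm)).1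
      · refine (Finset.sum_eq_zero fun e he => if_neg fun ⟨m, hm⟩ => hx ?_).symm
        rw [← hm]
        exact (Finset.mem_filter.mp he).2
    · simp_rw [hpv]
      simp
  obtain ⟨φ, hφ, -⟩ := F.exists_hom
  intro h0
  have h1 := hφ v
  rw [h0, map_zero] at h1
  have h2 := congrFun (LinearMap.congr_fun h1 fun _ => 1) (v, 0)
  rw [hpv, if_pos rfl] at h2
  exact zero_ne_one h2

instance [Nonempty V] : Nontrivial (LeavittPathAlgebra K G) :=
  let ⟨v⟩ := ‹Nonempty V›
  ⟨⟨_, _, vertex_ne_zero K G v⟩⟩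

end LeavittPathAlgebra

/-- The ring of Laurent polynomials over a field is a principal ideal ring. -/
instance laurentPolynomial_isPrincipalIdealRing (K : Type*) [Field K] :
    IsPrincipalIdealRing (LaurentPolynomial K) where
  principal I := by
    obtain ⟨g, hg⟩ := (IsPrincipalIdealRing.principal
      (I.under (Polynomial K))).principal
    refine ⟨⟨algebraMap _ _ g, ?_⟩⟩
    -- An ideal of a localization is generated by its contraction, here a principal ideal of `K[X]`.
    rw [← IsLocalization.map_under (Submonoid.powers (Polynomial.X : Polynomial K)) _ I, hg,
      Ideal.submodule_span_eq, Ideal.map_span, Set.image_singleton, Ideal.submodule_span_eq]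

/-! ### Paths to a terminal vertex and corners of the Leavitt path algebra -/

namespace LeavittPathAlgebra

open LaurentPolynomial

variable {K : Type*} [Field K] {V E : Type*} [Fintype V] [Fintype E] [DecidableEq V]
  {G : DirectedGraph V E} {t : V}

variable (K G t) in
/-- `Route K G t u x y n`: for some path of length `n` from `u` to `t` that does not visit `t`
before its end, `x` is the product of its edges and `y` is the product of its ghost edges. -/
inductive Route : V → LeavittPathAlgebra K G → LeavittPathAlgebra K G → ℕ → Prop
  | nil : Route t (vertex K G t) (vertex K G t) 0
  | cons (e : E) {x y : LeavittPathAlgebra K G} {n : ℕ} (he : G.s e ≠ t) (h : Route (G.r e) x y n) :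
      Route (G.s e) (edge K G e * x) (y * ghost K G e) (n + 1)

variable (K G t) in
/-- `GhostPath K G t u z`: `z` is the product of the ghost edges of some path from `u` to `t`. -/
inductive GhostPath : V → LeavittPathAlgebra K G → Prop
  | nil : GhostPath t (vertex K G t)
  | cons (e : E) {z : LeavittPathAlgebra K G} (h : GhostPath (G.r e) z) :
      GhostPath (G.s e) (z * ghost K G e)

variable (K) in
theorem exists_route {u : V} (h : G.Reach u t) : ∃ x y n, Route K G t u x y n := by
  induction h using Relation.ReflTransGen.head_induction_on with
  | refl => exact ⟨_, _, _, .nil⟩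
  | @head u _ hstep _ ih =>
    obtain ⟨e, rfl, rfl⟩ := hstep
    obtain ⟨x, y, n, h⟩ := ih
    by_cases he : G.s e = t
    · rw [he]; exact ⟨_, _, _, .nil⟩
    · exact ⟨_, _, _, .cons e he h⟩

variable {u : V} {x y x' y' z : LeavittPathAlgebra K G} {n n' : ℕ}

namespace Route

theorem ghostPath (h : Route K G t u x y n) : GhostPath K G t u y := by
  induction h with
  | nil => exact .nil
  | cons e _ _ ih => exact .cons e ih

theorem vertex_mul (h : Route K G t u x y n) : vertex K G u * x = x := by
  cases h with
  | nil => exact vertex_mul_self K G t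
  | cons e _ h => rw [← mul_assoc, source_mul_edge]

theorem mul_vertex (h : Route K G t u x y n) : x * vertex K G t = x := by
  induction h with
  | nil => exact vertex_mul_self K G t
  | cons e _ _ ih => rw [mul_assoc, ih]

theorem vertex_mul_ghost (h : Route K G t u x y n) : vertex K G t * y = y := by
  induction h with
  | nil => exact vertex_mul_self K G t
  | cons e _ _ ih => rw [← mul_assoc, ih]

/-- This order of the factors telescopes in every graph, by `e* e = r(e)`; the order in
`path_mul_ghost` uses that terminal vertices emit a single edge. -/
theorem ghost_mul_path (h : Route K G t u x y n) : y * x = vertex K G t := by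
  induction h with
  | nil => exact vertex_mul_self K G t
  | cons e _ h ih =>
    rw [mul_assoc, ← mul_assoc (ghost K G e), ghost_mul_edge_self, h.vertex_mul, ih]

theorem grading (h : Route K G t u x y n)
    {D : LeavittPathAlgebra K G →ₐ[K] (LeavittPathAlgebra K G)[T;T⁻¹]}
    (hv : ∀ v, D (vertex K G v) = C (vertex K G v) * T 0)
    (he : ∀ e, D (edge K G e) = C (edge K G e) * T 1)
    (hg : ∀ e, D (ghost K G e) = C (ghost K G e) * T (-1)) :
    D x = C x * T n ∧ D y = C y * T (-n) := by
  induction h with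
  | nil => exact ⟨hv t, by rw [hv]; simp⟩
  | cons e _ _ ih =>
    refine ⟨?_, ?_⟩
    · rw [map_mul, he, ih.1, C_mul_T_mul_C_mul_T, add_comm (1 : ℤ)]; push_cast; rfl
    · rw [map_mul, hg, ih.2, C_mul_T_mul_C_mul_T, ← neg_add]; push_cast; rfl

theorem eq_vertex (h : Route K G t u x y n) (hu : u = t) : y = vertex K G t := by
  cases h with
  | nil => rfl
  | cons e he _ => exact absurd hu he

/-- A terminal vertex emits at most one edge, so the path followed until the first visit to `t` is
unique. -/
theorem eq_ghost (hG : G.NoExit) (hu : G.IsTerminal u) (h : Route K G t u x y n)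
    (h' : Route K G t u x' y' n') : y = y' := by
  induction h generalizing x' y' n' with
  | nil => exact (h'.eq_vertex rfl).symm
  | cons e he _ ih =>
    generalize hw : G.s e = w at h'
    cases h' with
    | nil => exact absurd hw he
    | cons f hf h' =>
      obtain rfl := hG.eq_of_isTerminal hu hw.symm
      rw [ih hu.range h']

end Route

variable (K) in
theorem edge_mul_ghost (hG : G.NoExit) {e : E} (he : G.IsTerminal (G.s e)) :
    edge K G e * ghost K G e = vertex K G (G.s e) := by
  have : (Finset.univ.filter fun f => G.s f = G.s e) = {e} := by
    ext f
    simp only [Finset.mem_filter, Finset.mem_univ, true_and, Finset.mem_singleton]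
    exact ⟨fun h => hG.eq_of_isTerminal he h, fun h => h ▸ rfl⟩
  rw [vertex_eq_sum K G ⟨e, rfl⟩, this, Finset.sum_singleton]

theorem Route.path_mul_ghost (hG : G.NoExit) (hu : G.IsTerminal u) (h : Route K G t u x y n) :
    x * y = vertex K G u := by
  induction h with
  | nil => exact vertex_mul_self K G t
  | @cons e x y n _ _ ih =>
    rw [mul_assoc, ← mul_assoc x, ih hu.range, ← mul_assoc, edge_mul_range, edge_mul_ghost K hG hu]

theorem GhostPath.reach (h : GhostPath K G t u z) : G.Reach u t := by
  induction h with
  | nil => exact .refl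
  | cons e _ ih => exact (DirectedGraph.reach_edge e).trans ih

theorem GhostPath.eq_vertex (h : GhostPath K G t u z) (ht : ∀ e, G.s e ≠ t) (hu : u = t) :
    z = vertex K G t := by
  cases h with
  | nil => rfl
  | cons e _ => exact absurd hu (ht e)

theorem GhostPath.mul_vertex (h : GhostPath K G t u z) : z * vertex K G u = z := by
  cases h with
  | nil => exact vertex_mul_self K G t
  | cons e _ => rw [mul_assoc, ghost_mul_source]

theorem GhostPath.mul_vertex_of_ne (h : GhostPath K G t u z) {v : V} (huv : u ≠ v) :
    z * vertex K G v = 0 := by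
  rw [← h.mul_vertex, mul_assoc, vertex_mul_of_ne K G huv, mul_zero]

theorem GhostPath.mul_edge_of_ne (h : GhostPath K G t u z) {e : E} (hu : u ≠ G.s e) :
    z * edge K G e = 0 := by
  rw [← source_mul_edge, ← mul_assoc, h.mul_vertex_of_ne hu, zero_mul]

theorem GhostPath.mul_ghost_of_ne (h : GhostPath K G t u z) {e : E} (hu : u ≠ G.r e) :
    z * ghost K G e = 0 := by
  rw [← range_mul_ghost, ← mul_assoc, h.mul_vertex_of_ne hu, zero_mul]

/-- The right ideal generated by a vertex `t` is spanned by the products of an element of `A` and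
ghost paths, provided that edges out of `t` can be expressed in this way. -/
theorem mul_mem_span_ghostPath {A : Submodule K (LeavittPathAlgebra K G)}
    (hA : ∀ a ∈ A, a * vertex K G t = a)
    (hedge : ∀ e, G.s e = t → ∀ a ∈ A, ∃ b ∈ A, ∃ z, GhostPath K G t (G.r e) z ∧
      a * edge K G e = b * z) (r m : LeavittPathAlgebra K G)
    (hm : m ∈ Submodule.span K {w | ∃ a ∈ A, ∃ u z, GhostPath K G t u z ∧ w = a * z}) :
    m * r ∈ Submodule.span K {w | ∃ a ∈ A, ∃ u z, GhostPath K G t u z ∧ w = a * z} := by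
  set S := {w | ∃ a ∈ A, ∃ u z, GhostPath K G t u z ∧ w = a * z} with hS
  have gen : ∀ r, (∀ a ∈ A, ∀ u z, GhostPath K G t u z → a * (z * r) ∈ Submodule.span K S) →
      ∀ m ∈ Submodule.span K S, m * r ∈ Submodule.span K S := by
    intro r h m hm
    induction hm using Submodule.span_induction with
    | mem w hw =>
      obtain ⟨a, ha, u, z, hz, rfl⟩ := hw
      rw [mul_assoc]
      exact h a ha u z hz
    | zero => rw [zero_mul]; exact zero_mem _
    | add a b _ _ ha hb => rw [add_mul]; exact add_mem ha hb
    | smul c a _ ha => rw [smul_mul_assoc]; exact Submodule.smul_mem _ _ ha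
  induction r using induction generalizing m with
  | hscalar c =>
    rw [← Algebra.commutes, ← Algebra.smul_def]
    exact Submodule.smul_mem _ _ hm
  | hvertex v =>
    refine gen _ (fun a ha u z hz => ?_) m hm
    by_cases huv : u = v
    · subst huv
      rw [hz.mul_vertex]
      exact Submodule.subset_span ⟨a, ha, u, z, hz, rfl⟩
    · rw [hz.mul_vertex_of_ne huv, mul_zero]
      exact zero_mem _
  | hghost e =>
    refine gen _ (fun a ha u z hz => ?_) m hm
    by_cases hu : u = G.r e
    · subst hu
      exact Submodule.subset_span ⟨a, ha, _, _, hz.cons e, rfl⟩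
    · rw [hz.mul_ghost_of_ne hu, mul_zero]
      exact zero_mem _
  | hedge e =>
    refine gen _ (fun a ha u z hz => ?_) m hm
    by_cases hu : u = G.s e
    · cases hz with
      | nil =>
        obtain ⟨b, hb, z, hz, hz'⟩ := hedge e hu.symm a ha
        rw [← mul_assoc, hA a ha, hz']
        exact Submodule.subset_span ⟨b, hb, _, z, hz, rfl⟩
      | cons f hf =>
        rw [mul_assoc]
        by_cases hef : f = e
        · subst hef
          rw [ghost_mul_edge_self, hf.mul_vertex]
          exact Submodule.subset_span ⟨a, ha, _, _, hf, rfl⟩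
        · rw [ghost_mul_edge_of_ne K G hef, mul_zero, mul_zero]
          exact zero_mem _
    · rw [hz.mul_edge_of_ne hu, mul_zero]
      exact zero_mem _
  | hadd a b ha hb => rw [mul_add]; exact add_mem (ha m hm) (hb m hm)
  | hmul a b ha hb => rw [← mul_assoc]; exact hb _ (ha m hm)

/-- Cutting by `v` on the right keeps only ghost paths of paths from `v` to `t`. The subspace `A`
will be `R t`, `K t`, or the image of the Laurent polynomials. -/
theorem corner_mem_span {A : Submodule K (LeavittPathAlgebra K G)} (ht : vertex K G t ∈ A)
    (hA : ∀ a ∈ A, a * vertex K G t = a)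
    (hedge : ∀ e, G.s e = t → ∀ a ∈ A, ∃ b ∈ A, ∃ z, GhostPath K G t (G.r e) z ∧
      a * edge K G e = b * z) (r : LeavittPathAlgebra K G) (v : V) :
    vertex K G t * r * vertex K G v ∈
      Submodule.span K {w | ∃ a ∈ A, ∃ z, GhostPath K G t v z ∧ w = a * z} := by
  have h := mul_mem_span_ghostPath hA hedge r (vertex K G t)
    (Submodule.subset_span ⟨_, ht, t, _, .nil, (vertex_mul_self K G t).symm⟩)
  generalize vertex K G t * r = m at h ⊢
  induction h using Submodule.span_induction with
  | mem w hw =>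
    obtain ⟨a, ha, u, z, hz, rfl⟩ := hw
    by_cases huv : u = v
    · subst huv
      rw [mul_assoc, hz.mul_vertex]
      exact Submodule.subset_span ⟨a, ha, z, hz, rfl⟩
    · rw [mul_assoc, hz.mul_vertex_of_ne huv, mul_zero]
      exact zero_mem _
  | zero => rw [zero_mul]; exact zero_mem _
  | add a b _ _ ha hb => rw [add_mul]; exact add_mem ha hb
  | smul c a _ ha => rw [smul_mul_assoc]; exact Submodule.smul_mem _ _ ha

/-! ### Corners at terminal vertices. -/

variable (K) in
theorem corner_eq_zero (hG : G.NoExit) (ht : G.IsTerminal t) {v : V} (hv : ¬ G.Reach v t)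
    (r : LeavittPathAlgebra K G) : vertex K G t * r * vertex K G v = 0 := by
  have h := corner_mem_span (t := t)
    (A := LinearMap.range (LinearMap.mulRight K (vertex K G t)))
    ⟨vertex K G t, vertex_mul_self K G t⟩
    (by rintro _ ⟨a, rfl⟩; simp [mul_assoc, vertex_mul_self])
    (by
      rintro e rfl a -
      obtain ⟨x, y, n, h⟩ := exists_route K ht.reach_range
      -- Along the route back to `t`, `x y = r(e)`, so `a e = (a e x) y` with `a e x` in `R t`.
      refine ⟨a * edge K G e * x, ⟨a * edge K G e * x, ?_⟩, y, h.ghostPath, ?_⟩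
      · rw [LinearMap.mulRight_apply, mul_assoc, h.mul_vertex]
      · rw [mul_assoc, h.path_mul_ghost hG ht.range, mul_assoc, edge_mul_range]) r v
  have hempty : {w | ∃ a ∈ LinearMap.range (LinearMap.mulRight K (vertex K G t)),
      ∃ z, GhostPath K G t v z ∧ w = a * z} = ∅ :=
    Set.eq_empty_of_forall_notMem fun w ⟨_, _, z, hz, _⟩ => hv hz.reach
  rwa [hempty, Submodule.span_empty, Submodule.mem_bot] at h

variable (K) in
/-- The corner of the Leavitt path algebra at a sink is the field of coefficients. -/
theorem nonempty_cornerIso_sink (ht : ∀ e, G.s e ≠ t) :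
    Nonempty (CornerIso K (LeavittPathAlgebra K G) (vertex K G t)) := by
  refine ⟨⟨(LinearMap.toSpanSingleton K _ (vertex K G t)).toAddMonoidHom, fun a b => ?_, ?_,
    ?_, fun r => ?_⟩⟩
  · simp [vertex_mul_self, smul_smul, mul_comm]
  · simp
  · exact fun a b h => smul_left_injective K (vertex_ne_zero K G t) h
  · change vertex K G t * r * vertex K G t ∈
      LinearMap.range (LinearMap.toSpanSingleton K _ (vertex K G t))
    have h := corner_mem_span (t := t) (A := Submodule.span K {vertex K G t})
      (Submodule.mem_span_singleton_self _)
      (fun a ha => by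
        obtain ⟨c, rfl⟩ := Submodule.mem_span_singleton.mp ha
        rw [smul_mul_assoc, vertex_mul_self])
      (fun e he => absurd he (ht e)) r t
    refine Submodule.span_le.mpr ?_ h
    rintro _ ⟨a, ha, z, hz, rfl⟩
    obtain ⟨c, rfl⟩ := Submodule.mem_span_singleton.mp ha
    have hz' : z = vertex K G t := hz.eq_vertex ht rfl
    exact ⟨c, by rw [hz', smul_mul_assoc, vertex_mul_self]; rfl⟩

/-- From a terminal vertex the only paths to `s(e)` are the first-visit route followed by `k` turns
of the cycle; taking ghosts reverses the order. -/
theorem GhostPath.eq_pow_mul (hG : G.NoExit) {e : E} {x₀ y₀ : LeavittPathAlgebra K G} {n₀ : ℕ}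
    (h₀ : Route K G (G.s e) (G.r e) x₀ y₀ n₀) (hz : GhostPath K G (G.s e) u z)
    (hu : G.IsTerminal u) (h : Route K G (G.s e) u x y n) :
    ∃ k : ℕ, z = (y₀ * ghost K G e) ^ k * y := by
  induction hz generalizing x y n with
  | nil => exact ⟨0, by rw [pow_zero, one_mul]; exact Route.eq_ghost hG hu .nil h⟩
  | @cons f z hz ih =>
    obtain ⟨x', y', n', h'⟩ := exists_route K hz.reach
    obtain ⟨k, rfl⟩ := ih hu.range h'
    by_cases hf : G.s f = G.s e
    · obtain rfl := hG.eq_of_isTerminal (e := f) hu hf.symm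
      refine ⟨k + 1, ?_⟩
      rw [← Route.eq_ghost hG hu .nil h, ← Route.eq_ghost hG hu.range h₀ h', pow_succ]
      simp only [mul_assoc, ghost_mul_source]
    · exact ⟨k, by rw [mul_assoc, Route.eq_ghost hG hu h (h'.cons f hf)]⟩

variable (K) in
/-- The corner of the Leavitt path algebra at a vertex of a cycle without exits is the ring of
Laurent polynomials. -/
theorem nonempty_cornerIso_cycle (hG : G.NoExit) {e : E} (ht : G.IsTerminal (G.s e)) :
    Nonempty (CornerIso K[T;T⁻¹] (LeavittPathAlgebra K G) (vertex K G (G.s e))) := by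
  obtain ⟨x, y, n, hR⟩ := exists_route K ht.reach_range
  set p := vertex K G (G.s e) with hp
  set c := edge K G e * x with hc
  set d := y * ghost K G e with hd
  have hpp : p * p = p := vertex_mul_self K G _
  have hpc : p * c = c := by rw [hc, ← mul_assoc, source_mul_edge]
  have hcp : c * p = c := by rw [hc, mul_assoc, hR.mul_vertex]
  have hpd : p * d = d := by rw [hd, ← mul_assoc, hR.vertex_mul_ghost]
  have hdp : d * p = d := by rw [hd, mul_assoc, ghost_mul_source]
  have hcd : c * d = p := by
    rw [hc, hd, mul_assoc, ← mul_assoc x, hR.path_mul_ghost hG ht.range, ← mul_assoc,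
      edge_mul_range, edge_mul_ghost K hG ht]
  have hdc : d * c = p := by
    rw [hc, hd, mul_assoc, ← mul_assoc (ghost K G e), ghost_mul_edge_self, hR.vertex_mul,
      hR.ghost_mul_path]
  -- The cycle `c` is invertible only in the corner; adding `1 - p` makes it a unit of the whole
  -- algebra, and multiplication by `p` later returns to the corner.
  let U : (LeavittPathAlgebra K G)ˣ :=
    { val := c + (1 - p)
      inv := d + (1 - p)
      val_inv := by simp [add_mul, mul_add, sub_mul, mul_sub, hcd, hcp, hpd, hpp]
      inv_val := by simp [add_mul, mul_add, sub_mul, mul_sub, hdc, hpc, hdp, hpp] }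
  have hUp : (U : LeavittPathAlgebra K G) * p = p * c := by
    change (c + (1 - p)) * p = p * c
    simp [add_mul, sub_mul, hcp, hpc, hpp]
  have hU'p : ((U⁻¹ : (LeavittPathAlgebra K G)ˣ) : LeavittPathAlgebra K G) * p = p * d := by
    change (d + (1 - p)) * p = p * d
    simp [add_mul, sub_mul, hdp, hpd, hpp]
  have hcomm : Commute (U : LeavittPathAlgebra K G) p := by
    change (c + (1 - p)) * p = p * (c + (1 - p))
    simp [add_mul, mul_add, sub_mul, mul_sub, hcp, hpc, hpp]
  let g : K[T;T⁻¹] →ₐ[K] LeavittPathAlgebra K G := AddMonoidAlgebra.lift K _ ℤ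
    ((Units.coeHom _).comp (zpowersHom _ U))
  have hg : ∀ (k : ℤ) (a : K), g (.single k a) = a • ((U ^ k : (LeavittPathAlgebra K G)ˣ) :
      LeavittPathAlgebra K G) := fun k a => AddMonoidAlgebra.lift_single _ _ _
  have hgcomm : ∀ a, g a * p = p * g a := by
    intro a
    induction a using AddMonoidAlgebra.induction_linear with
    | zero => simp
    | add a b ha hb => rw [map_add, add_mul, mul_add, ha, hb]
    | single k a =>
      rw [hg, smul_mul_assoc, mul_smul_comm]
      exact congrArg (a • ·) (hcomm.units_zpow_left k)
  let f : K[T;T⁻¹] →ₗ[K] LeavittPathAlgebra K G := (LinearMap.mulRight K p).comp g.toLinearMap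
  have hf : ∀ a, f a = g a * p := fun _ => rfl
  have hfp : ∀ a, f a * p = f a := fun a => by rw [hf, mul_assoc, hpp]
  have hmul : ∀ a b, f (a * b) = f a * f b := fun a b => by
    rw [hf, hf, hf, map_mul, mul_assoc, mul_assoc, ← mul_assoc p, ← hgcomm b, mul_assoc, hpp]
  have hone : f 1 = p := by rw [hf, map_one, one_mul]
  have hT : ∀ k : ℤ, f (T k) = ((U ^ k : (LeavittPathAlgebra K G)ˣ) : LeavittPathAlgebra K G) * p :=
    fun k => by rw [hf, LaurentPolynomial.T, hg, one_smul]
  have hT1 : f (T 1) = c := by rw [hT, zpow_one, hUp, hpc]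
  have hTneg : f (T (-1)) = d := by rw [hT, zpow_neg_one, hU'p, hpd]
  have hTnat : ∀ k : ℕ, f (T (-k)) = d ^ k * p := by
    intro k
    induction k with
    | zero => simp [hone]
    | succ k ih =>
      rw [Nat.cast_succ, neg_add, T_add, hmul, ih, hTneg, pow_succ, mul_assoc, mul_assoc, hpd, hdp]
  -- injectivity of `f`, by means of the grading
  obtain ⟨D, hDv, hDe, hDg⟩ := exists_grading K G
  obtain ⟨hDx, hDy⟩ := hR.grading hDv hDe hDg
  have hDc : D c = C c * T ((n : ℤ) + 1) := by
    rw [hc, map_mul, hDe, hDx, C_mul_T_mul_C_mul_T, add_comm]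
  have hDd : D d = C d * T (-((n : ℤ) + 1)) := by
    rw [hd, map_mul, hDg, hDy, C_mul_T_mul_C_mul_T, neg_add]
  -- The cycle consists of `e` and a route of `n` edges, so `T k` lands in degree `k (n + 1)`.
  -- Distinct `k` give distinct degrees, and the grading reads off the coefficients.
  have hDT : ∀ k : ℤ, D (f (T k)) = C (f (T k)) * T (k * ((n : ℤ) + 1)) := by
    intro k
    induction k using Int.induction_on with
    | zero => rw [T_zero, hone, hDv, zero_mul]
    | succ k ih =>
      rw [T_add, hmul, map_mul, ih, hT1, hDc, C_mul_T_mul_C_mul_T, add_mul, one_mul]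
    | pred k ih =>
      rw [sub_eq_add_neg, T_add, hmul, map_mul, ih, hTneg, hDd, C_mul_T_mul_C_mul_T, add_mul,
        neg_one_mul]
  have hfT : ∀ k, f (T k) ≠ 0 := fun k h => by
    refine vertex_ne_zero K G (G.s e) ?_
    rw [← hp, ← hone, ← T_zero, ← add_neg_cancel k, T_add, hmul, h, zero_mul]
  have hsingle : ∀ (k : ℤ) (a : K), f (.single k a) = a • f (T k) := fun k a => by
    rw [← map_smul, LaurentPolynomial.T, AddMonoidAlgebra.smul_single, smul_eq_mul, mul_one]
  have hcoeff : ∀ (a : K[T;T⁻¹]) (k : ℤ),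
      (D (f a)).coeff (k * ((n : ℤ) + 1)) = a.coeff k • f (T k) := by
    intro a k
    induction a using AddMonoidAlgebra.induction_linear with
    | zero => simp
    | add a b ha hb =>
      rw [map_add, map_add, AddMonoidAlgebra.coeff_add, AddMonoidAlgebra.coeff_add,
        Finsupp.add_apply, Finsupp.add_apply, ha, hb, add_smul]
    | single j a =>
      rw [hsingle, map_smul, hDT, ← single_eq_C_mul_T, AddMonoidAlgebra.coeff_smul,
        Finsupp.smul_apply, AddMonoidAlgebra.coeff_single, AddMonoidAlgebra.coeff_single]
      by_cases hjk : j = k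
      · subst hjk; simp
      · have : j * ((n : ℤ) + 1) ≠ k * ((n : ℤ) + 1) := fun h =>
          hjk (mul_right_cancel₀ (by positivity) h)
        rw [Finsupp.single_eq_of_ne this.symm, Finsupp.single_eq_of_ne (Ne.symm hjk), smul_zero,
          zero_smul]
  have hinj : Function.Injective f := by
    rw [← LinearMap.ker_eq_bot, LinearMap.ker_eq_bot']
    intro a ha
    ext k
    have h := hcoeff a k
    rw [ha, map_zero] at h
    exact (smul_eq_zero.mp h.symm).resolve_right (hfT k)
  refine ⟨⟨f.toAddMonoidHom, hmul, hone, hinj, fun r => ?_⟩⟩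
  change p * r * p ∈ LinearMap.range f
  have h := corner_mem_span (t := G.s e) (A := LinearMap.range f) ⟨1, hone⟩
    (by rintro _ ⟨a, rfl⟩; exact hfp a)
    (by
      rintro e' he' _ ⟨a, rfl⟩
      obtain rfl := hG.eq_of_isTerminal ht he'
      -- Since `c y = e x y = e`, one has `f(a) e = f(a T) y`.
      refine ⟨f (a * T 1), ⟨_, rfl⟩, y, hR.ghostPath, ?_⟩
      rw [hmul, hT1, hc, mul_assoc, mul_assoc, hR.path_mul_ghost hG ht.range, edge_mul_range])
    r (G.s e)
  refine Submodule.span_le.mpr ?_ h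
  rintro _ ⟨_, ⟨a, rfl⟩, z, hz, rfl⟩
  obtain ⟨k, rfl⟩ := hz.eq_pow_mul hG hR ht .nil
  exact ⟨a * T (-k), by rw [hmul, hTnat]⟩

end LeavittPathAlgebra

/-! ### Direct finiteness and cancellation -/

namespace LeavittPathAlgebra

universe u v w

variable {K : Type u} [Field K] {V : Type v} {E : Type w} [Fintype V] [Fintype E] [DecidableEq V]
  {G : DirectedGraph V E}

/-- With `c = e x` and `d = y e*`, the elements `d + (1 - v)` and `c + (1 - v)` extend `d c = v` to
a one-sided inverse in the whole algebra. -/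
theorem noExit_of_isDirectlyFinite (h : IsDirectlyFinite (LeavittPathAlgebra K G)) :
    G.NoExit := by
  rintro p hp f ⟨e, he, hs, hne⟩
  obtain ⟨x, y, n, hR⟩ := exists_route K (hp.reach he)
  set v := vertex K G (G.s e) with hv
  have hvv : v * v = v := vertex_mul_self K G _
  have hve : v * (edge K G e * x) = edge K G e * x := by rw [← mul_assoc, source_mul_edge]
  have hgv : y * ghost K G e * v = y * ghost K G e := by rw [mul_assoc, ghost_mul_source]
  have hvy : v * (y * ghost K G e) = y * ghost K G e := by rw [← mul_assoc, hR.vertex_mul_ghost]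
  have hxv : edge K G e * x * v = edge K G e * x := by rw [mul_assoc, hR.mul_vertex]
  have hyx : y * ghost K G e * (edge K G e * x) = v := by
    rw [mul_assoc, ← mul_assoc (ghost K G e), ghost_mul_edge_self, hR.vertex_mul,
      hR.ghost_mul_path]
  have hab : (y * ghost K G e + (1 - v)) * (edge K G e * x + (1 - v)) = 1 := by
    rw [add_mul, mul_add, mul_add, hyx, mul_sub, mul_one, hgv, sub_mul, one_mul, hve, sub_self,
      sub_self, mul_sub, mul_one, sub_mul, one_mul, hvv, sub_self]
    abel
  have hba := h _ _ hab
  have hxy : edge K G e * x * (y * ghost K G e) = v := by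
    rw [add_mul, mul_add, mul_add, mul_sub, mul_one, hxv, sub_self, sub_mul, one_mul, hvy,
      sub_self, mul_sub, mul_one, sub_mul, one_mul, hvv, sub_self, sub_zero, add_zero,
      zero_add] at hba
    rw [← sub_eq_zero]
    calc _ = edge K G e * x * (y * ghost K G e) + (1 - v) - 1 := by abel
      _ = 0 := by rw [hba, sub_self]
  refine vertex_ne_zero K G (G.r f) ?_
  calc vertex K G (G.r f) = ghost K G f * (v * edge K G f) := by
        rw [hv, ← hs, source_mul_edge, ghost_mul_edge_self]
    _ = (ghost K G f * edge K G e) * (x * (y * ghost K G e) * edge K G f) := by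
        rw [← hxy]; simp only [mul_assoc]
    _ = 0 := by rw [ghost_mul_edge_of_ne K G hne, zero_mul]

variable (K) in
theorem nonempty_cornerIso (hG : G.NoExit) {t : V} (ht : G.IsTerminal t) :
    ∃ (A : Type u) (_ : CommRing A) (_ : IsDomain A) (_ : IsPrincipalIdealRing A),
      Nonempty (CornerIso A (LeavittPathAlgebra K G) (vertex K G t)) := by
  by_cases h : ∃ e, G.s e = t
  · obtain ⟨e, rfl⟩ := h
    exact ⟨LaurentPolynomial K, inferInstance, inferInstance, inferInstance,
      nonempty_cornerIso_cycle K hG ht⟩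
  · exact ⟨K, inferInstance, inferInstance, inferInstance,
      nonempty_cornerIso_sink K fun e he => h ⟨e, he⟩⟩

variable (K) in
/-- The vertices that represent the terminal classes generate the unit ideal. -/
theorem one_mem_closure (hG : G.NoExit) : (1 : LeavittPathAlgebra K G) ∈
    AddSubmonoid.closure {z | ∃ (q : G.TerminalClass) (x y : LeavittPathAlgebra K G),
      x * vertex K G q.rep = x ∧ vertex K G q.rep * y = y ∧ z = x * y} := by
  rw [one_eq_sum]
  suffices h : ∀ v, _ from sum_mem fun v _ => h v
  intro v
  induction v using hG.induction with
  | hterm v hv =>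
    obtain ⟨q, hq⟩ := hv.exists_rep
    obtain ⟨x, y, n, h⟩ := exists_route K hq
    exact AddSubmonoid.subset_closure
      ⟨q, x, y, h.mul_vertex, h.vertex_mul_ghost,
        (h.path_mul_ghost hG hv).symm⟩
  | hstep v hv ih =>
    -- A non-terminal vertex is `∑ e r(e) e*`, and multiplying by `e` and `e*` on the two sides
    -- preserves the form `x y`.
    rw [vertex_eq_sum K G hv]
    refine sum_mem fun e he => ?_
    have h := ih e (Finset.mem_filter.mp he).2
    rw [← edge_mul_range]
    generalize vertex K G (G.r e) = z at h
    induction h using AddSubmonoid.closure_induction with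
    | mem z hz =>
      obtain ⟨q, x, y, hx, hy, rfl⟩ := hz
      refine AddSubmonoid.subset_closure ⟨q, edge K G e * x, y * ghost K G e, ?_, ?_, ?_⟩
      · rw [mul_assoc, hx]
      · rw [← mul_assoc, hy]
      · simp only [mul_assoc]
    | zero => rw [mul_zero, zero_mul]; exact zero_mem _
    | add a b _ _ ha hb => rw [mul_add, add_mul]; exact add_mem ha hb

theorem hasCancellationOfProjectives (hG : G.NoExit) :
    HasCancellationOfProjectives (LeavittPathAlgebra K G) := by
  -- The summands of `1` supply the finite family `x`, `y`, with `τ` recording the terminal class of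
  -- each.
  obtain ⟨l, hl, hsum⟩ := AddSubmonoid.exists_list_of_mem_closure (one_mem_closure K hG)
  choose τ x y hx hy hxy using fun i : Fin l.length => hl l[i] (List.getElem_mem _)
  choose A i₁ i₂ i₃ f using fun q : G.TerminalClass => nonempty_cornerIso K hG q.2
  refine hasCancellationOfProjectives_of_corners (fun q => vertex K G q.rep)
    (fun q q' h r => corner_eq_zero K hG q.2 (DirectedGraph.TerminalClass.not_reach h) r) x y τ hx hy ?_ A
    fun q => (f q).some
  simp_rw [← hxy]
  exact (Fin.sum_univ_getElem l).trans hsum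

end LeavittPathAlgebra

theorem theorem5p2 (K : Type*) [Field K] {V E : Type*} [Fintype V] [Fintype E] [DecidableEq V]
    [Nonempty V] (G : DirectedGraph V E) :
    List.TFAE
      [HasCancellationOfProjectives (LeavittPathAlgebra K G),
        IsHermiteRing (LeavittPathAlgebra K G),
        IsStablyFinite (LeavittPathAlgebra K G),
        IsDirectlyFinite (LeavittPathAlgebra K G),
        G.NoExit] := by
  tfae_have 1 → 2 := fun h => h.isHermiteRing
  tfae_have 2 → 3 := fun h => h.isStablyFinite
  tfae_have 3 → 4 := fun h => h.isDirectlyFinite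
  tfae_have 4 → 5 := LeavittPathAlgebra.noExit_of_isDirectlyFinite
  tfae_have 5 → 1 := LeavittPathAlgebra.hasCancellationOfProjectives
  tfae_finish
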